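/- Let $u>0$. Three qubit matrices are the complex $8\times 8$ matrices acting on $\mathbb C^2\otimes\mathbb C^2\otimes\mathbb C^2$ (parties $A,B,C$), written in the basis $|000\rangle,|001\rangle,\dots,|111\rangle$ in lexicographic order. A state is a positive semi-definite matrix of trace one; a pure product state is $|\xi\rangle\langle\xi|$ with $|\xi\rangle=|x\rangle\otimes|y\rangle\otimes|z\rangle$ a unit vector; a separable state is a convex combination of pure product states, and its length is the least number of pure product states in such a combination. Put $\langle V,\varrho\rangle=\operatorname{Tr}(\varrho V^{\mathrm t})$. An entanglement witness is a self-adjoint $V$ with $\langle V,\varrho\rangle\ge 0$ for all separable states $\varrho$ and $\langle V,\varrho\rangle<0$ for some state $\varrho$. The dual face of $V$ is the set of all separable states $\varrho$ with $\langle V,\varrho\rangle=0$. For $a,b,c\in\mathbb R^4$ let $X(a,b,c)$ be the matrix with diagonal $(a_1,a_2,a_3,a_4,b_4,b_3,b_2,b_1)$, anti-diagonal $(c_1,c_2,c_3,c_4,c_4,c_3,c_2,c_1)$ and all other entries zero. Let $$W=X\big((0,0,0,\sqrt 8\,u^{-1}),(0,0,0,\sqrt 8\,u),(1,1,-1,1)\big)$$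 and, for $P\in\{A,B,C\}$, let $W_P=\sigma_P W^{\Gamma_P}\sigma_P$, where $\Gamma_P$ is the partial transpose with respect to party $P$ and $\sigma_P$ is the bit flip $\begin{pmatrix}0&1\\1&0\end{pmatrix}$ on party $P$ (tensored with the identity on the others). With $\omega=e^{\mathrm i\pi/4}$ let $\Lambda_1=(\omega^3,\omega,\omega^7)$, $\Lambda_2=(\omega^3,-\omega,-\omega^7)$, $\Lambda_3=(-\omega^3,\omega,-\omega^7)$, $\Lambda_4=(-\omega^3,-\omega,\omega^7)$, $\Lambda_j=\overline{\Lambda_{j-4}}$ for $j=5,\dots,8$, and for $p,q,r>0$ and $\Lambda_j=(\alpha,\beta,\gamma)$ let $$|\eta_j(p,q,r)\rangle=(pqr)^{-1/2}\,(p,\alpha)^{\mathrm t}\otimes(q,\beta)^{\mathrm t}\otimes(r,\gamma)^{\mathrm t}.$$ **Theorem.** Each of $W+W_A+W_B$, $W+W_B+W_C$, $W+W_C+W_A$ and $W_A+W_B+W_C$ is an entanglement witness. Let $F$ be the dual face of one of them. Then: (i) $F$ is affinely isomorphic to the $9$-dimensional simplex, and it has exactly ten extreme points, namely the (normalized) pure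 product states given by the product vectors - $|010\rangle,\ |101\rangle,\ |\eta_j(1,1,u^{-1})\rangle$ $(j=1,\dots,8)$ for $W+W_A+W_B$, - $|000\rangle,\ |111\rangle,\ |\eta_j(u,1,1)\rangle$ $(j=1,\dots,8)$ for $W+W_B+W_C$, - $|001\rangle,\ |110\rangle,\ |\eta_j(1,u^{-1},1)\rangle$ $(j=1,\dots,8)$ for $W+W_C+W_A$, - $|011\rangle,\ |100\rangle,\ |\eta_j(u,u^{-1},u^{-1})\rangle$ $(j=1,\dots,8)$ for $W_A+W_B+W_C$. (ii) Every point of $F$ is a separable state that has a unique decomposition as a convex combination of distinct pure product states with positive weights (up to the order of the terms). (iii) Every (relative) interior point of $F$ is a boundary separable state with full ranks, that is, it lies on the boundary of the convex set of all separable states (relative to its affine hull) and its partial transposes with respect to all subsets of the parties have full rank eight; and it has length exactly ten. -/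

import Mathlib

open scoped Kronecker ComplexOrder

noncomputable section

namespace ThreeQubit

/-- Labels `(i, j, k)` of the computational basis of `ℂ² ⊗ ℂ² ⊗ ℂ²`. -/
abbrev Idx : Type := Fin 2 × Fin 2 × Fin 2

/-- Three qubit matrices `M₂ ⊗ M₂ ⊗ M₂`. -/
abbrev Mat : Type := Matrix Idx Idx ℂ

/-- The product vector `|x⟩ ⊗ |y⟩ ⊗ |z⟩`. -/
def prodVec (x y z : Fin 2 → ℂ) : Idx → ℂ := fun i => x i.1 * y i.2.1 * z i.2.2

/-- The (normalized) pure state on the line spanned by a nonzero vector `v`,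
namely `|v⟩⟨v| / ⟨v|v⟩`. -/
def pureState (v : Idx → ℂ) : Mat := (star v ⬝ᵥ v)⁻¹ • Matrix.vecMulVec v (star v)

/-- Three qubit states: density matrices. -/
def states : Set Mat := {ρ | ρ.PosSemidef ∧ ρ.trace = 1}

/-- Pure product states `|ξ⟩⟨ξ|`, with `|ξ⟩` a product vector of norm one. -/
def pureProductStates : Set Mat :=
  {ρ | ∃ x y z : Fin 2 → ℂ, star (prodVec x y z) ⬝ᵥ prodVec x y z = 1 ∧
    ρ = Matrix.vecMulVec (prodVec x y z) (star (prodVec x y z))}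

/-- Separable states: convex combinations of pure product states. -/
def separableStates : Set Mat := convexHull ℝ pureProductStates

/-- The bilinear pairing `⟨V, ρ⟩ = Tr (ρ Vᵗ)`. -/
def pairing (V ρ : Mat) : ℂ := (ρ * V.transpose).trace

/-- Entanglement witnesses: self-adjoint matrices, nonnegative on all separable states and
negative on some state. -/
def IsEntanglementWitness (V : Mat) : Prop :=
  V.IsHermitian ∧ (∀ ρ ∈ separableStates, 0 ≤ (pairing V ρ).re) ∧
    ∃ ρ ∈ states, (pairing V ρ).re < 0

/-- The dual face of `V`: all separable states `ρ` with `⟨V, ρ⟩ = 0`. -/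
def dualFace (V : Mat) : Set Mat := {ρ ∈ separableStates | pairing V ρ = 0}

/-- The partial transpose with respect to the parties in `S`, where `0`, `1`, `2` stand for
the parties `A`, `B`, `C`. -/
def partialTranspose (S : Finset (Fin 3)) (M : Mat) : Mat := Matrix.of fun i j =>
  M (if 0 ∈ S then j.1 else i.1, if 1 ∈ S then j.2.1 else i.2.1, if 2 ∈ S then j.2.2 else i.2.2)
    (if 0 ∈ S then i.1 else j.1, if 1 ∈ S then i.2.1 else j.2.1, if 2 ∈ S then i.2.2 else j.2.2)

/-- The bit bitFlip on one qubit. -/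
def bitFlip : Matrix (Fin 2) (Fin 2) ℂ := !![0, 1; 1, 0]

def flipA : Mat := bitFlip ⊗ₖ ((1 : Matrix (Fin 2) (Fin 2) ℂ) ⊗ₖ (1 : Matrix (Fin 2) (Fin 2) ℂ))

def flipB : Mat := (1 : Matrix (Fin 2) (Fin 2) ℂ) ⊗ₖ (bitFlip ⊗ₖ (1 : Matrix (Fin 2) (Fin 2) ℂ))

def flipC : Mat := (1 : Matrix (Fin 2) (Fin 2) ℂ) ⊗ₖ ((1 : Matrix (Fin 2) (Fin 2) ℂ) ⊗ₖ bitFlip)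

/-- The position of a label in the lexicographic order `000, 001, …, 111`. -/
def lexPos (i : Idx) : Fin 8 := ⟨4 * i.1 + 2 * i.2.1 + i.2.2, by omega⟩

/-- Kye's X-shaped witness with parameter `u`, in the lexicographically ordered basis. -/
def W (u : ℝ) : Mat := Matrix.submatrix
  (!![0, 0,  0, 0, 0, 0, 0, 1;
      0, 0,  0, 0, 0, 0, 1, 0;
      0, 0,  0, 0, 0, -1, 0, 0;
      0, 0,  0, ((√8 * u⁻¹ : ℝ) : ℂ), 1, 0, 0, 0;
      0, 0,  0, 1, ((√8 * u : ℝ) : ℂ), 0, 0, 0;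
      0, 0, -1, 0, 0, 0, 0, 0;
      0, 1,  0, 0, 0, 0, 0, 0;
      1, 0,  0, 0, 0, 0, 0, 0] : Matrix (Fin 8) (Fin 8) ℂ) lexPos lexPos

def WA (u : ℝ) : Mat := flipA * partialTranspose {0} (W u) * flipA

def WB (u : ℝ) : Mat := flipB * partialTranspose {1} (W u) * flipB

def WC (u : ℝ) : Mat := flipC * partialTranspose {2} (W u) * flipC

/-- The primitive eighth root of unity `e^{iπ/4}`. -/
def ω : ℂ := Complex.exp (Complex.I * (Real.pi / 4))

/-- The eight phase triples; the last four are the complex conjugates of the first four. -/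
def phase : Fin 8 → Fin 3 → ℂ :=
  ![![ω ^ 3, ω, ω ^ 7],
    ![ω ^ 3, -ω, -ω ^ 7],
    ![-ω ^ 3, ω, -ω ^ 7],
    ![-ω ^ 3, -ω, ω ^ 7],
    star ![ω ^ 3, ω, ω ^ 7],
    star ![ω ^ 3, -ω, -ω ^ 7],
    star ![-ω ^ 3, ω, -ω ^ 7],
    star ![-ω ^ 3, -ω, ω ^ 7]]

/-- The product vectors `(pqr)^{-1/2} (p, α)ᵗ ⊗ (q, β)ᵗ ⊗ (r, γ)ᵗ`, with `(α, β, γ)` the `j`-th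
phase triple. -/
def eta (p q r : ℝ) (j : Fin 8) : Idx → ℂ :=
  (√(p * q * r))⁻¹ • prodVec ![(p : ℂ), phase j 0] ![(q : ℂ), phase j 1] ![(r : ℂ), phase j 2]

/-- Two sets in real vector spaces are affinely isomorphic: an affine map restricts to a
bijection between them. -/
def AffinelyIsomorphic {E E' : Type*} [AddCommGroup E] [Module ℝ E] [AddCommGroup E']
    [Module ℝ E'] (S : Set E) (T : Set E') : Prop :=
  ∃ f : E →ᵃ[ℝ] E', Set.BijOn f S T

/-- `w` is a decomposition of `ρ` into pure product states: the convex combination of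
finitely many distinct pure product states `P`, with weights `w P`, that is equal to `ρ`. -/
def IsDecomposition (ρ : Mat) (w : Mat →₀ ℝ) : Prop :=
  (w.support : Set Mat) ⊆ pureProductStates ∧ (∀ P, 0 ≤ w P) ∧
    (w.sum fun _ a => a) = 1 ∧ (w.sum fun P a => a • P) = ρ

/-- The length of a separable state: the smallest number of pure product states of which it
is a convex combination. -/
def sepLength (ρ : Mat) : ℕ :=
  sInf {n | ∃ (P : Fin n → Mat) (c : Fin n → ℝ), (∀ i, P i ∈ pureProductStates) ∧
    (∀ i, 0 ≤ c i) ∧ ∑ i, c i = 1 ∧ ∑ i, c i • P i = ρ}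

/-- Boundary separable states with full ranks: on the boundary of the convex set of separable
states (relative to its affine hull), with all partial transposes of full rank. -/
def IsBoundarySeparableFullRanks (ρ : Mat) : Prop :=
  ρ ∈ separableStates ∧ ρ ∈ intrinsicFrontier ℝ separableStates ∧
    ∀ S : Finset (Fin 3), (partialTranspose S ρ).rank = 8

end ThreeQubit

end

open ThreeQubit

/-!
Entrywise multiplication by a product vector of positive weights reduces the four witnesses to one
form `√8 ∑ ‖ζ i‖² + 3 ∑ ± Re (ζ i conj (ζ (opp i)))`, the first sum omitting one antipodal pair of
labels. For a product vector `ζ` the modulus `m` of `ζ i ζ (opp i)` does not depend on `i`, so the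
first sum is at least `6 m` by AM-GM, while the second one is at least `-4√2 m`, by a bound on sums
of four cosines; equality forces `ζ` to be one of the two omitted basis vectors or one of the eight
phase vectors. The resulting ten pure product states are linearly independent, and linear
independence of the zeros of a functional that is nonnegative on `pureProductStates` gives the
simplex, the unique decompositions and the length. Partial transposition conjugates the phases of
some of the parties, which keeps the eight phase vectors a basis of `ℂ⁸`, whence full ranks.
-/

section ConvexHull

variable {E : Type*} [AddCommGroup E] [Module ℝ E] {s : Set E} {f : E →ₗ[ℝ] ℝ}

theorem map_eq_zero_of_map_sum_eq_zero {ι : Type*} (hf : ∀ x ∈ s, 0 ≤ f x) {t : Finset ι}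
    {c : ι → ℝ} {z : ι → E} (hc : ∀ i ∈ t, 0 ≤ c i) (hz : ∀ i ∈ t, z i ∈ s)
    (h0 : f (∑ i ∈ t, c i • z i) = 0) {i : ι} (hi : i ∈ t) (hci : c i ≠ 0) : f (z i) = 0 := by
  simp only [map_sum, map_smul, smul_eq_mul] at h0
  have := (Finset.sum_eq_zero_iff_of_nonneg
    fun i hi => mul_nonneg (hc i hi) (hf _ (hz i hi))).1 h0 i hi
  exact (mul_eq_zero.1 this).resolve_left hci

theorem convexHull_sep_map_eq_zero (hf : ∀ x ∈ s, 0 ≤ f x) :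
    {x ∈ convexHull ℝ s | f x = 0} = convexHull ℝ {x ∈ s | f x = 0} := by
  refine Set.Subset.antisymm ?_ fun x hx => ⟨convexHull_mono (Set.sep_subset _ _) hx, ?_⟩
  · rintro x ⟨hx, hfx⟩
    obtain ⟨ι, _, w, z, hw0, hw1, hz, rfl⟩ := mem_convexHull_iff_exists_fintype.1 hx
    rw [← Finset.centerMass_eq_of_sum_1 _ _ hw1, ← Finset.centerMass_filter_ne_zero]
    refine Finset.centerMass_mem_convexHull _ (fun i _ => hw0 i) ?_ fun i hi => ⟨hz i, ?_⟩
    · rw [Finset.sum_filter_ne_zero, hw1]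
      exact one_pos
    · exact map_eq_zero_of_map_sum_eq_zero hf (fun i _ => hw0 i) (fun i _ => hz i) hfx
        (Finset.mem_univ i) (Finset.mem_filter.1 hi).2
  · exact convexHull_min (fun y hy => hy.2) (convex_hyperplane f.isLinear 0) hx

theorem pos_of_mem_intrinsicInterior [TopologicalSpace E] [IsTopologicalAddGroup E]
    [ContinuousSMul ℝ E] (hf : ∀ x ∈ s, 0 ≤ f x) {y : E} (hy : y ∈ s) (hfy : 0 < f y) {x : E}
    (hx : x ∈ intrinsicInterior ℝ s) : 0 < f x := by
  obtain ⟨x, hx, rfl⟩ := mem_intrinsicInterior.1 hx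
  let γ : ℝ → affineSpan ℝ s := fun t => ⟨AffineMap.lineMap (x : E) y t,
    AffineMap.lineMap_mem t x.2 (subset_affineSpan ℝ s hy)⟩
  have hγ : Continuous γ := AffineMap.lineMap_continuous.subtype_mk _
  have hγ0 : γ 0 = x := Subtype.ext (AffineMap.lineMap_apply_zero _ _)
  have hev : ∀ᶠ t in nhds (0 : ℝ), γ t ∈ interior ((↑) ⁻¹' s : Set (affineSpan ℝ s)) :=
    hγ.continuousAt.eventually_mem (isOpen_interior.mem_nhds (by rwa [hγ0]))
  -- The segment from `y` to `x` can be prolonged a little beyond `x` inside `s`.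
  obtain ⟨t, ht, htneg⟩ := (hev.filter_mono nhdsWithin_le_nhds |>.and
    (self_mem_nhdsWithin (s := Set.Iio (0 : ℝ)))).exists
  have h0 : 0 ≤ (1 - t) * f x + t * f y := by
    have hmem : γ t ∈ ((↑) ⁻¹' s : Set (affineSpan ℝ s)) := interior_subset ht
    simpa only [γ, AffineMap.lineMap_apply_module, map_add, map_smul, smul_eq_mul] using hf _ hmem
  have hneg : t * f y < 0 := mul_neg_of_neg_of_pos htneg hfy
  have ht0 : t < 0 := htneg
  exact pos_of_mul_pos_right (by linarith) (sub_nonneg.2 (ht0.le.trans zero_le_one))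

variable {ι : Type*} {v : ι → E}

theorem exists_linearMap_apply_eq (hv : LinearIndependent ℝ v) (d : ι → ℝ) :
    ∃ f : E →ₗ[ℝ] ℝ, ∀ i, f (v i) = d i := by
  obtain ⟨g, hg⟩ := (Finsupp.linearCombination ℝ v).exists_leftInverse_of_injective
    (LinearMap.ker_eq_bot.2 hv)
  refine ⟨Finsupp.linearCombination ℝ d ∘ₗ g, fun i => ?_⟩
  have hgi : g (v i) = Finsupp.single i 1 := by
    simpa using LinearMap.congr_fun hg (Finsupp.single i 1)
  simp [hgi]

theorem extremePoints_convexHull_range (hv : LinearIndependent ℝ v) :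
    (convexHull ℝ (Set.range v)).extremePoints ℝ = Set.range v := by
  classical
  refine Set.Subset.antisymm extremePoints_convexHull_subset ?_
  rintro _ ⟨i, rfl⟩
  obtain ⟨f, hf⟩ := exists_linearMap_apply_eq hv (fun k => if k = i then 0 else 1)
  have hf0 : ∀ x ∈ Set.range v, 0 ≤ f x := by
    rintro _ ⟨k, rfl⟩
    rw [hf]
    split_ifs <;> norm_num
  have hface : {x ∈ convexHull ℝ (Set.range v) | f x = 0} = {v i} := by
    have : {x ∈ Set.range v | f x = 0} = {v i} := by
      ext x
      constructor
      · rintro ⟨⟨k, rfl⟩, hk⟩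
        by_contra h
        simp [hf, ne_of_apply_ne v h] at hk
      · rintro rfl
        simp [hf]
    rw [convexHull_sep_map_eq_zero hf0, this, convexHull_singleton]
  have hf0' : ∀ x ∈ convexHull ℝ (Set.range v), 0 ≤ f x :=
    convexHull_min hf0 (convex_halfSpace_ge f.isLinear 0)
  refine ⟨subset_convexHull ℝ _ ⟨i, rfl⟩, ?_⟩
  rintro x hx y hy ⟨a, b, ha, hb, -, hab⟩
  have h0 : a * f x + b * f y = 0 := by simpa [hf] using congrArg f hab
  have hfx : f x = 0 := by
    have := mul_nonneg hb.le (hf0' y hy)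
    exact (mul_eq_zero.1 (by linarith [mul_nonneg ha.le (hf0' x hx)])).resolve_left ha.ne'
  exact hface.subset ⟨hx, hfx⟩

variable [Fintype ι]

theorem convexHull_range_eq_image_stdSimplex (v : ι → E) :
    convexHull ℝ (Set.range v) = Fintype.linearCombination ℝ v '' stdSimplex ℝ ι := by
  classical
  rw [← convexHull_rangle_single_eq_stdSimplex, LinearMap.image_convexHull, ← Set.range_comp]
  congr 2
  ext i
  simp

theorem affinelyIsomorphic_convexHull_range (hv : LinearIndependent ℝ v) :
    AffinelyIsomorphic (stdSimplex ℝ ι) (convexHull ℝ (Set.range v)) := by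
  refine ⟨(Fintype.linearCombination ℝ v).toAffineMap, ?_⟩
  rw [convexHull_range_eq_image_stdSimplex]
  exact hv.fintypeLinearCombination_injective.injOn.bijOn_image

theorem exists_pos_of_mem_intrinsicInterior_convexHull [TopologicalSpace E]
    [IsTopologicalAddGroup E] [ContinuousSMul ℝ E] (hv : LinearIndependent ℝ v) {x : E}
    (hx : x ∈ intrinsicInterior ℝ (convexHull ℝ (Set.range v))) :
    ∃ c : ι → ℝ, (∀ i, 0 < c i) ∧ ∑ i, c i = 1 ∧ ∑ i, c i • v i = x := by
  classical
  obtain ⟨c, hc, rfl⟩ :=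
    (convexHull_range_eq_image_stdSimplex v).subset (intrinsicInterior_subset hx)
  refine ⟨c, fun i => ?_, hc.2, rfl⟩
  obtain ⟨f, hf⟩ := exists_linearMap_apply_eq hv (Pi.single i 1)
  have hf0 : ∀ y ∈ convexHull ℝ (Set.range v), 0 ≤ f y := by
    refine convexHull_min ?_ (convex_halfSpace_ge f.isLinear 0)
    rintro _ ⟨k, rfl⟩
    have h : 0 ≤ (Pi.single i 1 : ι → ℝ) := Pi.single_nonneg.2 zero_le_one
    exact (h k).trans_eq (hf k).symm
  have hpos := pos_of_mem_intrinsicInterior hf0 (subset_convexHull ℝ _ ⟨i, rfl⟩) (by simp [hf]) hx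
  simpa [Fintype.linearCombination_apply, hf, Pi.single_apply] using hpos

end ConvexHull

section PosDef

variable {n ι 𝕜 : Type*} [Finite n] [Fintype ι] [RCLike 𝕜]

theorem posDef_sum_smul_vecMulVec {v : ι → n → 𝕜} (hv : Submodule.span 𝕜 (Set.range v) = ⊤)
    {c : ι → ℝ} (hc : ∀ i, 0 < c i) :
    (∑ i, c i • Matrix.vecMulVec (v i) (star (v i))).PosDef := by
  have := Fintype.ofFinite n
  have hpsd (i : ι) := (Matrix.posSemidef_vecMulVec_self_star (v i)).smul (hc i).le
  refine .of_dotProduct_mulVec_pos (Matrix.posSemidef_sum _ fun i _ => hpsd i).isHermitian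
    fun x hx => ?_
  simp only [Matrix.sum_mulVec, dotProduct_sum]
  refine Finset.sum_pos' (fun i _ => (hpsd i).dotProduct_mulVec_nonneg x) ?_
  obtain ⟨i, hi⟩ : ∃ i, star x ⬝ᵥ v i ≠ 0 := by
    by_contra! h
    have hzero : dotProductBilin 𝕜 𝕜 (star x) = 0 := LinearMap.ext_on_range hv h
    exact hx (dotProduct_star_self_eq_zero.1 (LinearMap.congr_fun hzero x))
  refine ⟨i, Finset.mem_univ i, ?_⟩
  rw [Matrix.smul_mulVec, Matrix.vecMulVec_mulVec, Matrix.star_dotProduct (v i) x,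
    op_smul_eq_smul, dotProduct_smul, dotProduct_smul]
  exact smul_pos (hc i) (star_mul_self_pos (IsRegular.of_ne_zero hi))

end PosDef

namespace ThreeQubit

section Decomposition

variable {ι : Type*} {ρ : Mat} {f : Mat →ₗ[ℝ] ℝ} {v : ι → Mat}

theorem IsDecomposition.eq_of_linearIndependent (hf : ∀ P ∈ pureProductStates, 0 ≤ f P)
    (hv : LinearIndependent ℝ v) (hvf : {P ∈ pureProductStates | f P = 0} = Set.range v)
    (hfρ : f ρ = 0) {w w' : Mat →₀ ℝ} (hw : IsDecomposition ρ w) (hw' : IsDecomposition ρ w') :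
    w = w' := by
  have hsupp {w : Mat →₀ ℝ} (hw : IsDecomposition ρ w) : (w.support : Set Mat) ⊆ Set.range v := by
    intro P hP
    rw [← hvf]
    exact ⟨hw.1 hP, map_eq_zero_of_map_sum_eq_zero hf (fun Q _ => hw.2.1 Q) (fun Q hQ => hw.1 hQ)
      ((congrArg f hw.2.2.2).trans hfρ) hP (Finsupp.mem_support_iff.1 hP)⟩
  refine linearIndepOn_iffₛ.1 hv.linearIndepOn_id w (hsupp hw) w' (hsupp hw') ?_
  simpa only [Finsupp.linearCombination_apply, id] using hw.2.2.2.trans hw'.2.2.2.symm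

variable [Fintype ι]

theorem isDecomposition_mapDomain {P : ι → Mat} {c : ι → ℝ} (hP : ∀ i, P i ∈ pureProductStates)
    (hc0 : ∀ i, 0 ≤ c i) (hc1 : ∑ i, c i = 1) (hρ : ∑ i, c i • P i = ρ) :
    IsDecomposition ρ ((Finsupp.equivFunOnFinite.symm c).mapDomain P) := by
  classical
  have hc : 0 ≤ Finsupp.equivFunOnFinite.symm c := hc0
  refine ⟨fun x hx => ?_, Finsupp.mapDomain_nonneg hc, ?_, ?_⟩
  · obtain ⟨i, -, rfl⟩ := Finset.mem_image.1 (Finsupp.mapDomain_support hx)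
    exact hP i
  · rw [Finsupp.sum_mapDomain_index (fun _ => rfl) fun _ _ _ => rfl,
      Finsupp.sum_fintype _ _ fun _ => rfl]
    exact hc1
  · rw [Finsupp.sum_mapDomain_index (h := fun P a => a • P)
      (fun P => zero_smul ℝ P) fun P a b => add_smul a b P,
      Finsupp.sum_fintype _ _ fun i => zero_smul ℝ (P i)]
    exact hρ

theorem exists_isDecomposition (hρ : ρ ∈ separableStates) : ∃ w, IsDecomposition ρ w := by
  obtain ⟨_, _, _, _, hc0, hc1, hP, hsum⟩ := mem_convexHull_iff_exists_fintype.1 hρ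
  exact ⟨_, isDecomposition_mapDomain hP hc0 hc1 hsum⟩

theorem sepLength_eq_card_support {w : Mat →₀ ℝ} (hw : IsDecomposition ρ w)
    (huniq : ∀ w', IsDecomposition ρ w' → w' = w) : sepLength ρ = w.support.card := by
  classical
  refine IsLeast.csInf_eq ⟨?_, ?_⟩
  · obtain ⟨hP, h0, h1, hsum⟩ := hw
    let e := w.support.equivFin.symm
    refine ⟨fun k => e k, fun k => w (e k), fun k => hP (e k).2, fun k => h0 _, ?_, ?_⟩
    · rw [e.sum_comp (fun P => w P), Finset.sum_coe_sort w.support (fun P => w P)]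
      exact h1
    · rw [e.sum_comp (fun P => w P • (P : Mat)), Finset.sum_coe_sort w.support (fun P => w P • P)]
      exact hsum
  · rintro n ⟨P, c, hP, hc0, hc1, hρ⟩
    rw [← huniq _ (isDecomposition_mapDomain hP hc0 hc1 hρ)]
    calc _ ≤ (Finset.univ.image P).card :=
          Finset.card_le_card (Finsupp.mapDomain_support.trans
            (Finset.image_subset_image (Finset.subset_univ _)))
      _ ≤ n := Finset.card_image_le.trans_eq (Finset.card_fin n)

theorem sepLength_eq_card_of_pos (hf : ∀ P ∈ pureProductStates, 0 ≤ f P)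
    (hv : LinearIndependent ℝ v) (hvf : {P ∈ pureProductStates | f P = 0} = Set.range v)
    {c : ι → ℝ} (hc0 : ∀ i, 0 < c i) (hc1 : ∑ i, c i = 1) (hρ : ∑ i, c i • v i = ρ) :
    sepLength ρ = Fintype.card ι := by
  classical
  have hmem (i : ι) : v i ∈ pureProductStates ∧ f (v i) = 0 := hvf.superset ⟨i, rfl⟩
  have hdec := isDecomposition_mapDomain (fun i => (hmem i).1) (fun i => (hc0 i).le) hc1 hρ
  have hfρ : f ρ = 0 := by simp [← hρ, hmem]
  rw [sepLength_eq_card_support hdec fun w' hw' =>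
      hw'.eq_of_linearIndependent hf hv hvf hfρ hdec,
    Finsupp.mapDomain_support_of_injective hv.injective,
    Finset.card_image_of_injective _ hv.injective]
  congr 1
  ext i
  simp [(hc0 i).ne']

end Decomposition

section Labels

/-- The label opposite to `i`, so that `(i, opp i)` runs through the anti-diagonal positions. -/
def opp (i : Idx) : Idx := (1 - i.1, 1 - i.2.1, 1 - i.2.2)

theorem opp_involutive : Function.Involutive opp := by
  unfold Function.Involutive
  decide

theorem sum_idx {M : Type*} [AddCommMonoid M] (f : Idx → M) :
    ∑ i, f i = f (0, 0, 0) + f (0, 0, 1) + (f (0, 1, 0) + f (0, 1, 1)) +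
      (f (1, 0, 0) + f (1, 0, 1) + (f (1, 1, 0) + f (1, 1, 1))) := by
  simp only [Fintype.sum_prod_type, Fin.sum_univ_two]

/-- The label obtained from `i` by flipping the bit of party `k`. -/
def flipBit (k : Fin 3) (i : Idx) : Idx :=
  (if k = 0 then 1 - i.1 else i.1, if k = 1 then 1 - i.2.1 else i.2.1,
    if k = 2 then 1 - i.2.2 else i.2.2)

theorem flipBit_involutive (k : Fin 3) : Function.Involutive (flipBit k) := by
  unfold Function.Involutive
  revert k
  decide

/-- The label `i` with the bits of the parties in `S` replaced by those of `j`. -/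
def swapBits (S : Finset (Fin 3)) (i j : Idx) : Idx :=
  (if 0 ∈ S then j.1 else i.1, if 1 ∈ S then j.2.1 else i.2.1, if 2 ∈ S then j.2.2 else i.2.2)

theorem partialTranspose_apply (S : Finset (Fin 3)) (M : Mat) (i j : Idx) :
    partialTranspose S M i j = M (swapBits S i j) (swapBits S j i) :=
  rfl

theorem swapBits_flipBit_eq_iff {k : Fin 3} {i j : Idx} :
    swapBits {k} (flipBit k i) (flipBit k j) = swapBits {k} (flipBit k j) (flipBit k i) ↔
      i = j := by
  revert k i j
  decide

theorem swapBits_flipBit_eq_opp_iff {k : Fin 3} {i j : Idx} :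
    swapBits {k} (flipBit k j) (flipBit k i) = opp (swapBits {k} (flipBit k i) (flipBit k j)) ↔
      j = opp i := by
  revert k i j
  decide

theorem swapBits_flipBit_self (k : Fin 3) (i : Idx) :
    swapBits {k} (flipBit k i) (flipBit k i) = flipBit k i := by
  revert k i
  decide

theorem swapBits_flipBit_opp (k : Fin 3) (i : Idx) :
    swapBits {k} (flipBit k i) (flipBit k (opp i)) = i := by
  revert k i
  decide

theorem bitFlip_apply (i j : Fin 2) : bitFlip i j = if j = 1 - i then 1 else 0 := by
  fin_cases i <;> fin_cases j <;> simp [bitFlip]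

/-- The bit flip on party `k`, tensored with the identity on the other parties. -/
def flipMatrix (k : Fin 3) : Mat := (flipBit_involutive k).toPerm.permMatrix ℂ

theorem flipMatrix_apply (k : Fin 3) (i j : Idx) :
    flipMatrix k i j = if flipBit k i = j then 1 else 0 := by
  simp [flipMatrix, Equiv.Perm.permMatrix, PEquiv.toMatrix_apply]

theorem flipMatrix_mul_mul_apply (k : Fin 3) (M : Mat) (i j : Idx) :
    (flipMatrix k * M * flipMatrix k) i j = M (flipBit k i) (flipBit k j) := by
  rw [flipMatrix, Equiv.Perm.permMatrix, PEquiv.toMatrix_toPEquiv_mul,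
    PEquiv.mul_toMatrix_toPEquiv]
  rfl

theorem flipA_eq_flipMatrix : flipA = flipMatrix 0 := by
  ext i j
  simp only [flipA, Matrix.kroneckerMap_apply, bitFlip_apply, Matrix.one_apply, flipMatrix_apply,
    flipBit, Prod.ext_iff, mul_ite, mul_one, mul_zero]
  split_ifs <;> simp_all

theorem flipB_eq_flipMatrix : flipB = flipMatrix 1 := by
  ext i j
  simp only [flipB, Matrix.kroneckerMap_apply, bitFlip_apply, Matrix.one_apply, flipMatrix_apply,
    flipBit, Prod.ext_iff, mul_ite, mul_one, mul_zero]
  split_ifs <;> simp_all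

theorem flipC_eq_flipMatrix : flipC = flipMatrix 2 := by
  ext i j
  simp only [flipC, Matrix.kroneckerMap_apply, bitFlip_apply, Matrix.one_apply, flipMatrix_apply,
    flipBit, Prod.ext_iff, mul_ite, mul_one, mul_zero]
  split_ifs <;> simp_all

end Labels

section XMatrix

/-- The X-shaped matrix with diagonal entries `d i` and anti-diagonal entries `c i` at the
positions `(i, opp i)`. -/
def xMatrix (d c : Idx → ℝ) : Mat := Matrix.of fun i j =>
  (if i = j then (d i : ℂ) else 0) + if j = opp i then (c i : ℂ) else 0

theorem xMatrix_add (d c d' c' : Idx → ℝ) :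
    xMatrix d c + xMatrix d' c' = xMatrix (d + d') (c + c') := by
  ext i j
  simp only [xMatrix, Matrix.add_apply, Matrix.of_apply, Pi.add_apply]
  split_ifs <;> push_cast <;> ring

theorem isHermitian_xMatrix (d : Idx → ℝ) {c : Idx → ℝ} (hc : ∀ i, c (opp i) = c i) :
    (xMatrix d c).IsHermitian := by
  ext i j
  have hopp : i = opp j ↔ j = opp i := opp_involutive.eq_iff.symm.trans eq_comm
  simp only [Matrix.conjTranspose_apply, xMatrix, Matrix.of_apply, star_add, hopp,
    eq_comm (a := j) (b := i), apply_ite (star : ℂ → ℂ), star_zero, Complex.star_def,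
    Complex.conj_ofReal]
  congr 1
  · grind
  · grind

theorem flipMatrix_mul_partialTranspose_xMatrix_mul (k : Fin 3) (d c : Idx → ℝ) :
    flipMatrix k * partialTranspose {k} (xMatrix d c) * flipMatrix k =
      xMatrix (d ∘ flipBit k) c := by
  ext i j
  simp only [flipMatrix_mul_mul_apply, partialTranspose_apply, xMatrix, Matrix.of_apply,
    swapBits_flipBit_eq_iff, swapBits_flipBit_eq_opp_iff, Function.comp_apply]
  congr 1
  · split_ifs with h
    · rw [← h, swapBits_flipBit_self]
    · rfl
  · split_ifs with h
    · rw [h, swapBits_flipBit_opp]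
    · rfl

end XMatrix

section Witness

variable (p q r u : ℝ) (b : Idx)

/-- The diagonal entries of `W u`. -/
noncomputable def wDiag : Idx → ℝ := fun i =>
  if i = (0, 1, 1) then √8 * u⁻¹ else if i = (1, 0, 0) then √8 * u else 0

/-- The anti-diagonal signs `(1, 1, -1, 1)` of `W u`. -/
def antiSign (i : Idx) : ℝ := if i = (0, 1, 0) ∨ i = (1, 0, 1) then -1 else 1

theorem antiSign_opp (i : Idx) : antiSign (opp i) = antiSign i := by
  have h : (opp i = (0, 1, 0) ∨ opp i = (1, 0, 1)) ↔ (i = (0, 1, 0) ∨ i = (1, 0, 1)) := by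
    revert i
    decide
  simp only [antiSign, h]

theorem W_eq_xMatrix : W u = xMatrix (wDiag u) antiSign := by
  ext ⟨i₀, i₁, i₂⟩ ⟨j₀, j₁, j₂⟩
  fin_cases i₀ <;> fin_cases i₁ <;> fin_cases i₂ <;> fin_cases j₀ <;> fin_cases j₁ <;>
    fin_cases j₂ <;> simp [W, lexPos, xMatrix, wDiag, antiSign, opp]

theorem WA_eq_xMatrix : WA u = xMatrix (wDiag u ∘ flipBit 0) antiSign := by
  rw [WA, flipA_eq_flipMatrix, W_eq_xMatrix, flipMatrix_mul_partialTranspose_xMatrix_mul]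

theorem WB_eq_xMatrix : WB u = xMatrix (wDiag u ∘ flipBit 1) antiSign := by
  rw [WB, flipB_eq_flipMatrix, W_eq_xMatrix, flipMatrix_mul_partialTranspose_xMatrix_mul]

theorem WC_eq_xMatrix : WC u = xMatrix (wDiag u ∘ flipBit 2) antiSign := by
  rw [WC, flipC_eq_flipMatrix, W_eq_xMatrix, flipMatrix_mul_partialTranspose_xMatrix_mul]

/-- The moduli of the entries of the product vectors `(p, α) ⊗ (q, β) ⊗ (r, γ)` with phases
`α`, `β`, `γ`. -/
def weight (i : Idx) : ℝ := ![p, 1] i.1 * ![q, 1] i.2.1 * ![r, 1] i.2.2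

/-- The diagonal of a witness that vanishes at `b` and `opp b`. -/
noncomputable def witnessDiag (i : Idx) : ℝ :=
  if i = b ∨ i = opp b then 0 else √8 * (weight p q r (opp i) / weight p q r i)

/-- The common form of the sums of three of the matrices `W`, `W_A`, `W_B`, `W_C`. -/
noncomputable def xWitness : Mat := xMatrix (witnessDiag p q r b) (3 • antiSign)

variable {p q r u}

theorem W_add_WA_add_WB : W u + WA u + WB u = xWitness 1 1 u⁻¹ (0, 1, 0) := by
  rw [W_eq_xMatrix, WA_eq_xMatrix, WB_eq_xMatrix, xMatrix_add, xMatrix_add, xWitness]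
  congr 1
  · ext ⟨i₀, i₁, i₂⟩
    fin_cases i₀ <;> fin_cases i₁ <;> fin_cases i₂ <;>
      simp [wDiag, flipBit, witnessDiag, weight, opp]
  · module

theorem W_add_WB_add_WC : W u + WB u + WC u = xWitness u 1 1 (0, 0, 0) := by
  rw [W_eq_xMatrix, WB_eq_xMatrix, WC_eq_xMatrix, xMatrix_add, xMatrix_add, xWitness]
  congr 1
  · ext ⟨i₀, i₁, i₂⟩
    fin_cases i₀ <;> fin_cases i₁ <;> fin_cases i₂ <;>
      simp [wDiag, flipBit, witnessDiag, weight, opp]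
  · module

theorem W_add_WC_add_WA : W u + WC u + WA u = xWitness 1 u⁻¹ 1 (0, 0, 1) := by
  rw [W_eq_xMatrix, WC_eq_xMatrix, WA_eq_xMatrix, xMatrix_add, xMatrix_add, xWitness]
  congr 1
  · ext ⟨i₀, i₁, i₂⟩
    fin_cases i₀ <;> fin_cases i₁ <;> fin_cases i₂ <;>
      simp [wDiag, flipBit, witnessDiag, weight, opp]
  · module

theorem WA_add_WB_add_WC (hu : u ≠ 0) :
    WA u + WB u + WC u = xWitness u u⁻¹ u⁻¹ (0, 1, 1) := by
  rw [WA_eq_xMatrix, WB_eq_xMatrix, WC_eq_xMatrix, xMatrix_add, xMatrix_add, xWitness]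
  congr 1
  · ext ⟨i₀, i₁, i₂⟩
    fin_cases i₀ <;> fin_cases i₁ <;> fin_cases i₂ <;>
      simp [wDiag, flipBit, witnessDiag, weight, opp, hu]
  · module

end Witness

section PureStates

theorem prodVec_smul (c : ℂ) (x y z : Fin 2 → ℂ) :
    prodVec (c • x) y z = c • prodVec x y z := by
  funext i
  simp only [prodVec, Pi.smul_apply, smul_eq_mul, mul_assoc]

theorem prodVec_mul (x x' y y' z z' : Fin 2 → ℂ) :
    prodVec (x * x') (y * y') (z * z') = prodVec x y z * prodVec x' y' z' := by
  funext i
  simp only [prodVec, Pi.mul_apply]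
  ring

theorem prodVec_single (i : Idx) :
    prodVec (Pi.single i.1 1) (Pi.single i.2.1 1) (Pi.single i.2.2 1) = Pi.single i 1 := by
  funext k
  simp only [prodVec, Pi.single_apply, Prod.ext_iff]
  grind

theorem pureState_of_unit {v : Idx → ℂ} (hv : star v ⬝ᵥ v = 1) :
    pureState v = Matrix.vecMulVec v (star v) := by
  rw [pureState, hv, inv_one, one_smul]

theorem pureState_smul {c : ℂ} (hc : c ≠ 0) (v : Idx → ℂ) : pureState (c • v) = pureState v := by
  have hc' : star c ≠ 0 := star_ne_zero.2 hc
  ext i j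
  simp only [pureState, Matrix.smul_apply, Matrix.vecMulVec_apply, Pi.smul_apply, Pi.star_apply,
    star_smul, smul_dotProduct, dotProduct_smul, smul_eq_mul, mul_inv]
  field_simp

theorem exists_pos_star_dotProduct_self {v : Idx → ℂ} (hv : v ≠ 0) :
    ∃ t : ℝ, 0 < t ∧ star v ⬝ᵥ v = t := by
  have hpos : 0 < star v ⬝ᵥ v := Matrix.dotProduct_star_self_pos_iff.2 hv
  obtain ⟨hre, him⟩ := Complex.pos_iff.1 hpos
  exact ⟨_, hre, Complex.ext rfl him.symm⟩

theorem exists_pos_pureState_eq_smul {v : Idx → ℂ} (hv : v ≠ 0) :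
    ∃ t : ℝ, 0 < t ∧ pureState v = t • Matrix.vecMulVec v (star v) := by
  obtain ⟨t, ht, hvt⟩ := exists_pos_star_dotProduct_self hv
  refine ⟨t⁻¹, inv_pos.2 ht, ?_⟩
  rw [pureState, hvt, ← Complex.ofReal_inv, Complex.coe_smul]

theorem pureState_mem_states {v : Idx → ℂ} (hv : v ≠ 0) : pureState v ∈ states := by
  obtain ⟨t, ht, htv⟩ := exists_pos_pureState_eq_smul hv
  refine ⟨htv ▸ (Matrix.posSemidef_vecMulVec_self_star v).smul ht.le, ?_⟩
  rw [pureState, Matrix.trace_smul, Matrix.trace_vecMulVec, dotProduct_comm v, smul_eq_mul]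
  exact inv_mul_cancel₀ (Matrix.dotProduct_star_self_pos_iff.2 hv).ne'

theorem pureState_prodVec_mem {x y z : Fin 2 → ℂ} (h : prodVec x y z ≠ 0) :
    pureState (prodVec x y z) ∈ pureProductStates := by
  obtain ⟨t, ht, hxyz⟩ := exists_pos_star_dotProduct_self h
  let c : ℝ := (√t)⁻¹
  have hc : (c : ℂ) ≠ 0 := Complex.ofReal_ne_zero.2 (inv_pos.2 (Real.sqrt_pos.2 ht)).ne'
  have hct : c * (c * t) = 1 := by
    rw [← mul_assoc, ← mul_inv, Real.mul_self_sqrt ht.le, inv_mul_cancel₀ ht.ne']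
  have hunit : star (prodVec ((c : ℂ) • x) y z) ⬝ᵥ prodVec ((c : ℂ) • x) y z = 1 := by
    rw [prodVec_smul, star_smul, smul_dotProduct, dotProduct_smul, hxyz, Complex.star_def,
      Complex.conj_ofReal, smul_eq_mul, smul_eq_mul]
    exact_mod_cast hct
  exact ⟨_, _, _, hunit, by rw [← pureState_of_unit hunit, prodVec_smul, pureState_smul hc]⟩

end PureStates

section Pairing

/-- The real part of `ρ ↦ ⟨V, ρ⟩`. -/
def pairingRe (V : Mat) : Mat →ₗ[ℝ] ℝ where
  toFun ρ := (pairing V ρ).re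
  map_add' ρ σ := by simp only [pairing, add_mul, Matrix.trace_add, Complex.add_re]
  map_smul' c ρ := by simp only [pairing, Matrix.smul_mul, Matrix.trace_smul, Complex.real_smul,
    Complex.re_ofReal_mul, RingHom.id_apply, smul_eq_mul]

theorem isHermitian_of_mem_separableStates {ρ : Mat} (hρ : ρ ∈ separableStates) :
    ρ.IsHermitian := by
  refine convexHull_min (t := selfAdjoint.submodule ℝ Mat) ?_ (Submodule.convex _) hρ
  rintro _ ⟨x, y, z, -, rfl⟩
  exact (Matrix.posSemidef_vecMulVec_self_star _).1

theorem pairing_im_eq_zero {V ρ : Mat} (hV : V.IsHermitian) (hρ : ρ.IsHermitian) :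
    (pairing V ρ).im = 0 := by
  rw [← Complex.conj_eq_iff_im, ← Complex.star_def, pairing, ← Matrix.trace_conjTranspose,
    Matrix.conjTranspose_mul, hρ.eq, hV.transpose.eq, Matrix.trace_mul_comm]

theorem dualFace_eq_sep_pairingRe {V : Mat} (hV : V.IsHermitian) :
    dualFace V = {ρ ∈ separableStates | pairingRe V ρ = 0} := by
  refine Set.sep_ext_iff.2 fun ρ hρ => ⟨congrArg Complex.re, fun h => Complex.ext h ?_⟩
  exact pairing_im_eq_zero hV (isHermitian_of_mem_separableStates hρ)

theorem pairingRe_xMatrix_vecMulVec (d c : Idx → ℝ) (ξ : Idx → ℂ) :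
    pairingRe (xMatrix d c) (Matrix.vecMulVec ξ (star ξ)) =
      ∑ i, d i * ‖ξ i‖ ^ 2 + ∑ i, c i * (ξ i * star (ξ (opp i))).re := by
  change (pairing _ _).re = _
  have hdiag (i : Idx) : ‖ξ i‖ ^ 2 = (ξ i * star (ξ i)).re := by
    rw [Complex.star_def, Complex.mul_conj, Complex.ofReal_re, Complex.normSq_eq_norm_sq]
  simp only [pairing, Matrix.trace, Matrix.diag_apply, Matrix.mul_apply, Matrix.transpose_apply,
    xMatrix, Matrix.of_apply, Matrix.vecMulVec_apply, Pi.star_apply, mul_add, mul_ite, mul_zero,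
    Finset.sum_add_distrib, Finset.sum_ite_eq, Finset.sum_ite_eq', Finset.mem_univ, if_true,
    Complex.add_re, Complex.re_sum, mul_comm _ (Complex.ofReal _), Complex.re_ofReal_mul, hdiag]

end Pairing

section WitnessForm

variable {p q r : ℝ} {b : Idx}

theorem weight_pos (hp : 0 < p) (hq : 0 < q) (hr : 0 < r) (i : Idx) : 0 < weight p q r i := by
  have hbit {s : ℝ} (hs : 0 < s) (k : Fin 2) : 0 < (![s, 1] : Fin 2 → ℝ) k := by
    fin_cases k
    exacts [hs, one_pos]
  exact mul_pos (mul_pos (hbit hp _) (hbit hq _)) (hbit hr _)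

theorem weight_mul_weight_opp (p q r : ℝ) (i : Idx) :
    weight p q r i * weight p q r (opp i) = p * q * r := by
  have hbit (s : ℝ) (k : Fin 2) : (![s, 1] : Fin 2 → ℝ) k * (![s, 1] : Fin 2 → ℝ) (1 - k) = s := by
    fin_cases k
    exacts [mul_one s, one_mul s]
  simp only [weight, opp]
  rw [mul_mul_mul_comm, hbit, mul_mul_mul_comm, hbit, hbit]

/-- The weights as a product vector, by whose entrywise multiplication the zeros of
`xWitness p q r b` arise from those of `xWitness 1 1 1 b`. -/
def weightVec (p q r : ℝ) : Idx → ℂ := prodVec ![(p : ℂ), 1] ![(q : ℂ), 1] ![(r : ℂ), 1]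

theorem weightVec_apply (p q r : ℝ) (i : Idx) : weightVec p q r i = weight p q r i := by
  have hbit (s : ℝ) (k : Fin 2) : (![(s : ℂ), 1] : Fin 2 → ℂ) k = (![s, 1] : Fin 2 → ℝ) k := by
    fin_cases k <;> simp
  simp only [weightVec, prodVec, hbit, weight, Complex.ofReal_mul]

/-- The value `⟨ζ| V |ζ⟩` for the unweighted witness `V = xWitness 1 1 1 b`. -/
noncomputable def witnessForm (b : Idx) (ζ : Idx → ℂ) : ℝ :=
  √8 * ∑ i ∈ {b, opp b}ᶜ, ‖ζ i‖ ^ 2 + 3 * ∑ i, antiSign i * (ζ i * star (ζ (opp i))).re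

theorem pairingRe_xWitness_vecMulVec (hp : 0 < p) (hq : 0 < q) (hr : 0 < r) (b : Idx)
    (ζ : Idx → ℂ) :
    pairingRe (xWitness p q r b) (Matrix.vecMulVec (weightVec p q r * ζ)
      (star (weightVec p q r * ζ))) = p * q * r * witnessForm b ζ := by
  simp only [xWitness, pairingRe_xMatrix_vecMulVec, witnessForm, mul_add, Pi.mul_apply,
    weightVec_apply]
  congr 1
  · rw [← Finset.sum_compl_add_sum {b, opp b}, Finset.sum_eq_zero (s := {b, opp b}), add_zero,
      Finset.mul_sum, Finset.mul_sum]
    · refine Finset.sum_congr rfl fun i hi => ?_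
      have hw := (weight_pos hp hq hr i).ne'
      have hi' : ¬(i = b ∨ i = opp b) := by simpa using hi
      rw [witnessDiag, if_neg hi', norm_mul, mul_pow, Complex.norm_real, Real.norm_eq_abs, sq_abs,
        ← weight_mul_weight_opp p q r i]
      field_simp
    · intro i hi
      rw [witnessDiag, if_pos (by simpa using hi), zero_mul]
  · rw [Finset.mul_sum, Finset.mul_sum]
    refine Finset.sum_congr rfl fun i _ => ?_
    rw [← weight_mul_weight_opp p q r i, star_mul', Complex.star_def, Complex.conj_ofReal,
      mul_mul_mul_comm, ← Complex.ofReal_mul, Complex.re_ofReal_mul, Pi.smul_apply, nsmul_eq_mul]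
    push_cast
    ring

/-- The off-diagonal part of the witness form of a product vector `x ⊗ y ⊗ z`, as a function of
the coherences `X = x₀ x̄₁`, `Y = y₀ ȳ₁`, `Z = z₀ z̄₁`. -/
def crossTerm (X Y Z : ℂ) : ℝ := (X * Y).re * Z.re + (X * star Y).im * Z.im

theorem sum_antiSign_mul_prodVec (x y z : Fin 2 → ℂ) :
    ∑ i, antiSign i * (prodVec x y z i * star (prodVec x y z (opp i))).re =
      4 * crossTerm (x 0 * star (x 1)) (y 0 * star (y 1)) (z 0 * star (z 1)) := by
  simp only [sum_idx, antiSign, opp, prodVec, crossTerm]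
  simp only [Prod.mk.injEq, zero_ne_one, one_ne_zero, and_true, and_false, and_self, or_self,
    or_false, or_true, ↓reduceIte, sub_zero, sub_self, star_mul', Complex.star_def,
    Complex.mul_re, Complex.mul_im, Complex.conj_re, Complex.conj_im]
  ring

theorem crossTerm_sq_le (X Y Z : ℂ) : crossTerm X Y Z ^ 2 ≤ 2 * (‖X‖ * ‖Y‖ * ‖Z‖) ^ 2 := by
  have hc : (X * Y).re ^ 2 ≤ (‖X‖ * ‖Y‖) ^ 2 := by
    rw [← norm_mul, ← sq_abs]
    gcongr
    exact Complex.abs_re_le_norm _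
  have hs : (X * star Y).im ^ 2 ≤ (‖X‖ * ‖Y‖) ^ 2 := by
    rw [← norm_star Y, ← norm_mul, ← sq_abs]
    gcongr
    exact Complex.abs_im_le_norm _
  calc crossTerm X Y Z ^ 2
      ≤ ((X * Y).re ^ 2 + (X * star Y).im ^ 2) * (Z.re ^ 2 + Z.im ^ 2) := by
        rw [crossTerm]
        nlinarith [sq_nonneg ((X * Y).re * Z.im - (X * star Y).im * Z.re)]
    _ ≤ ((‖X‖ * ‖Y‖) ^ 2 + (‖X‖ * ‖Y‖) ^ 2) * (Z.re ^ 2 + Z.im ^ 2) := by gcongr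
    _ = 2 * (‖X‖ * ‖Y‖ * ‖Z‖) ^ 2 := by
        rw [mul_pow _ ‖Z‖, ← Complex.normSq_eq_norm_sq Z, Complex.normSq_apply]
        ring

theorem neg_sqrt_two_mul_le_crossTerm (X Y Z : ℂ) :
    -(√2 * (‖X‖ * ‖Y‖ * ‖Z‖)) ≤ crossTerm X Y Z := by
  refine neg_le_of_abs_le (abs_le_of_sq_le_sq ?_ (by positivity))
  rw [mul_pow, Real.sq_sqrt zero_le_two]
  exact crossTerm_sq_le X Y Z

theorem norm_prodVec_mul_norm_prodVec_opp (x y z : Fin 2 → ℂ) (i : Idx) :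
    ‖prodVec x y z i‖ * ‖prodVec x y z (opp i)‖ =
      ‖x 0 * star (x 1)‖ * ‖y 0 * star (y 1)‖ * ‖z 0 * star (z 1)‖ := by
  have hbit (v : Fin 2 → ℂ) (k : Fin 2) : ‖v k‖ * ‖v (1 - k)‖ = ‖v 0 * star (v 1)‖ := by
    rw [norm_mul, norm_star]
    fin_cases k
    exacts [rfl, mul_comm _ _]
  simp only [prodVec, opp, norm_mul _ (z _), norm_mul (x _) (y _)]
  rw [mul_mul_mul_comm, hbit, mul_mul_mul_comm, hbit, hbit]

theorem sum_sq_eq_sum_sub_opp_sq {N : Idx → ℝ} {m : ℝ} (hN : ∀ i, N i * N (opp i) = m) (b : Idx) :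
    ∑ i ∈ {b, opp b}ᶜ, N i ^ 2 = (∑ i ∈ {b, opp b}ᶜ, (N i - N (opp i)) ^ 2) / 2 + 6 * m := by
  have hcard : ({b, opp b}ᶜ : Finset Idx).card = 6 := by
    revert b
    decide
  have hmem (i : Idx) : opp i ∈ ({b, opp b}ᶜ : Finset Idx) ↔ i ∈ ({b, opp b}ᶜ : Finset Idx) := by
    revert b i
    decide
  have hopp : ∑ i ∈ {b, opp b}ᶜ, N (opp i) ^ 2 = ∑ i ∈ {b, opp b}ᶜ, N i ^ 2 :=
    Finset.sum_equiv opp_involutive.toPerm (fun i => (hmem i).symm) fun _ _ => rfl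
  have hexp (i : Idx) : (N i - N (opp i)) ^ 2 = N i ^ 2 + N (opp i) ^ 2 - 2 * m := by
    rw [← hN i]
    ring
  simp only [hexp, Finset.sum_sub_distrib, Finset.sum_add_distrib, hopp, Finset.sum_const, hcard]
  ring

/- The arithmetic–geometric mean inequality on each pair `{i, opp i}` leaves exactly the room
`12 √2 m` needed to absorb the off-diagonal part, by `neg_sqrt_two_mul_le_crossTerm`. -/
theorem witnessForm_prodVec (x y z : Fin 2 → ℂ) (b : Idx) :
    witnessForm b (prodVec x y z) =
      √2 * ∑ i ∈ {b, opp b}ᶜ, (‖prodVec x y z i‖ - ‖prodVec x y z (opp i)‖) ^ 2 +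
      12 * (crossTerm (x 0 * star (x 1)) (y 0 * star (y 1)) (z 0 * star (z 1)) -
        -(√2 * (‖x 0 * star (x 1)‖ * ‖y 0 * star (y 1)‖ * ‖z 0 * star (z 1)‖))) := by
  have hsqrt : √8 = 2 * √2 := by
    rw [show (8 : ℝ) = 2 ^ 2 * 2 by norm_num, Real.sqrt_mul (by norm_num),
      Real.sqrt_sq zero_le_two]
  rw [witnessForm, sum_antiSign_mul_prodVec, hsqrt,
    sum_sq_eq_sum_sub_opp_sq (norm_prodVec_mul_norm_prodVec_opp x y z)]
  ring

theorem witnessForm_prodVec_nonneg (x y z : Fin 2 → ℂ) (b : Idx) :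
    0 ≤ witnessForm b (prodVec x y z) := by
  rw [witnessForm_prodVec]
  have := sub_nonneg.2 (neg_sqrt_two_mul_le_crossTerm (x 0 * star (x 1)) (y 0 * star (y 1))
    (z 0 * star (z 1)))
  positivity

theorem witnessForm_prodVec_eq_zero_iff {x y z : Fin 2 → ℂ} :
    witnessForm b (prodVec x y z) = 0 ↔
      (∀ i, i ≠ b → i ≠ opp b → ‖prodVec x y z i‖ = ‖prodVec x y z (opp i)‖) ∧
      crossTerm (x 0 * star (x 1)) (y 0 * star (y 1)) (z 0 * star (z 1)) =
        -(√2 * (‖x 0 * star (x 1)‖ * ‖y 0 * star (y 1)‖ * ‖z 0 * star (z 1)‖)) := by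
  have hcross := sub_nonneg.2 (neg_sqrt_two_mul_le_crossTerm (x 0 * star (x 1))
    (y 0 * star (y 1)) (z 0 * star (z 1)))
  rw [witnessForm_prodVec, add_eq_zero_iff_of_nonneg (by positivity) (by positivity),
    mul_eq_zero_iff_left (by positivity), mul_eq_zero_iff_left (by norm_num), sub_eq_zero,
    Finset.sum_eq_zero_iff_of_nonneg fun _ _ => sq_nonneg _]
  simp [sub_eq_zero]

end WitnessForm

section Phases

/-- The character table of the Klein four-group. Its last three columns hold the signs by which
the first four phase triples, and likewise the last four, differ from each other. -/
def kleinSign : Matrix (Fin 4) (Fin 4) ℝ := !![1, 1, 1, 1; 1, 1, -1, -1; 1, -1, 1, -1; 1, -1, -1, 1]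

/-- Representatives of the pairs `{i, opp i}`, chosen so that an odd number of bits is `1`. -/
def oddLabel : Fin 4 → Idx := ![(1, 1, 1), (1, 0, 0), (0, 1, 0), (0, 0, 1)]

theorem sum_kleinSign_mul_kleinSign (l m : Fin 4) :
    ∑ j, kleinSign l j * kleinSign j m = if l = m then 4 else 0 := by
  fin_cases l <;> fin_cases m <;> simp [kleinSign, Fin.sum_univ_four] <;> norm_num

theorem eq_zero_of_sum_kleinSign_smul {M : Type*} [AddCommGroup M] [Module ℝ M] {v : Fin 4 → M}
    (h : ∀ j, ∑ l, kleinSign j l • v l = 0) : v = 0 := by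
  funext l
  have h4 : (4 : ℝ) • v l = 0 := calc
    (4 : ℝ) • v l = ∑ m, (∑ j, kleinSign l j * kleinSign j m) • v m := by
      simp [sum_kleinSign_mul_kleinSign]
    _ = ∑ j, kleinSign l j • ∑ m, kleinSign j m • v m := by
      simp only [Finset.sum_smul, Finset.smul_sum, mul_smul]
      exact Finset.sum_comm
    _ = 0 := by simp [h]
  exact (smul_eq_zero.1 h4).resolve_left (by norm_num)

/-- The product vector `(1, a₀) ⊗ (1, a₁) ⊗ (1, a₂)`. -/
def phaseVec (a : Fin 3 → ℂ) : Idx → ℂ := prodVec ![1, a 0] ![1, a 1] ![1, a 2]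

/-- The triples obtained from `a` and from its complex conjugate by the sign changes of
`kleinSign`. -/
noncomputable def signedTriple (a : Fin 3 → ℂ) : Fin 8 → Fin 3 → ℂ :=
  Fin.append (m := 4) (n := 4) (fun j k => kleinSign j k.succ • a k)
    (fun j k => kleinSign j k.succ • star (a k))

theorem phase_eq_signedTriple : phase = signedTriple ![ω ^ 3, ω, ω ^ 7] := by
  funext j k
  fin_cases j <;> fin_cases k <;>
    simp [phase, signedTriple, kleinSign, Fin.append, Fin.addCases, -RCLike.star_def]

theorem phaseVec_kleinSign_smul (a : Fin 3 → ℂ) (j l : Fin 4) :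
    phaseVec (fun k => kleinSign j k.succ • a k) (oddLabel l) =
        kleinSign j l • phaseVec a (oddLabel l) ∧
      phaseVec (fun k => kleinSign j k.succ • a k) (opp (oddLabel l)) =
        kleinSign j l • phaseVec a (opp (oddLabel l)) := by
  fin_cases j <;> fin_cases l <;> simp [phaseVec, prodVec, oddLabel, opp, kleinSign]

theorem sqrt_two_mul_ω : √2 * ω = 1 + Complex.I := by
  have hω : ω = ((√2 / 2 : ℝ) : ℂ) * (1 + Complex.I) := by
    rw [ω, mul_comm, Complex.exp_mul_I, ← Real.cos_pi_div_four]
    norm_cast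
    rw [Real.sin_pi_div_four, Real.cos_pi_div_four]
    ring
  rw [hω, ← mul_assoc, ← Complex.ofReal_mul, mul_div_assoc', Real.mul_self_sqrt zero_le_two]
  norm_num

theorem ω_sq : ω ^ 2 = Complex.I := by
  have hsqrt : (√2 : ℂ) ^ 2 = 2 := by
    rw [← Complex.ofReal_pow, Real.sq_sqrt zero_le_two, Complex.ofReal_ofNat]
  refine mul_left_cancel₀ (two_ne_zero (α := ℂ)) ?_
  calc 2 * ω ^ 2 = (√2 * ω) ^ 2 := by rw [mul_pow, hsqrt]
    _ = 2 * Complex.I := by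
      rw [sqrt_two_mul_ω]
      linear_combination Complex.I_sq

theorem ω_pow_four : ω ^ 4 = -1 := by
  rw [show ω ^ 4 = (ω ^ 2) ^ 2 by ring, ω_sq, Complex.I_sq]

theorem ω_pow_seven : ω ^ 7 = -ω ^ 3 := by
  rw [show ω ^ 7 = ω ^ 4 * ω ^ 3 by ring, ω_pow_four, neg_one_mul]

theorem sqrt_two_mul_ω_pow_three : √2 * ω ^ 3 = -(1 - Complex.I) := by
  rw [show √2 * ω ^ 3 = ω ^ 2 * (√2 * ω) by ring, ω_sq, sqrt_two_mul_ω]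
  linear_combination Complex.I_sq

theorem star_ω : star ω = -ω ^ 3 := by
  have hsqrt : (√2 : ℂ) ≠ 0 := by simp
  refine mul_left_cancel₀ hsqrt ?_
  have h := congrArg star sqrt_two_mul_ω
  simp only [star_mul', star_add, star_one, Complex.star_def, Complex.conj_ofReal,
    Complex.conj_I] at h
  rw [Complex.star_def, h, mul_neg, sqrt_two_mul_ω_pow_three]
  ring

theorem star_ω_pow_three : star (ω ^ 3) = -ω := by
  rw [star_pow, star_ω]
  linear_combination (-ω ^ 5 + ω) * ω_pow_four

theorem phase_eq_of_ω : phase =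
    ![![ω ^ 3, ω, -ω ^ 3], ![ω ^ 3, -ω, ω ^ 3], ![-ω ^ 3, ω, ω ^ 3], ![-ω ^ 3, -ω, -ω ^ 3],
      ![-ω, -ω ^ 3, ω], ![-ω, ω ^ 3, -ω], ![ω, -ω ^ 3, -ω], ![ω, ω ^ 3, ω]] := by
  funext j k
  fin_cases j <;> fin_cases k <;>
    simp [phase, ω_pow_seven, star_ω, star_ω_pow_three, -star_pow, -RCLike.star_def]

/- Equality in the Cauchy–Schwarz inequality `c · Re Z + s · Im Z ≥ -|c + i s| |Z|` with
`c = Re (X Y)`, `s = Im (X Y*)`, where `|c|, |s| ≤ 1`. -/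
theorem mul_eq_and_mul_star_eq_of_crossTerm_eq {X Y Z : ℂ} (hX : ‖X‖ = 1) (hY : ‖Y‖ = 1)
    (hZ : ‖Z‖ = 1) (h : crossTerm X Y Z = -√2) :
    ∃ c s : ℝ, c ^ 2 = 1 ∧ s ^ 2 = 1 ∧ X * Y = c ∧ X * star Y = s * Complex.I ∧
      √2 * Z = -(c + s * Complex.I) := by
  have hsq (w : ℂ) (hw : ‖w‖ = 1) : w.re ^ 2 + w.im ^ 2 = 1 := by
    rw [← one_pow 2, ← hw, ← Complex.normSq_eq_norm_sq, Complex.normSq_apply]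
    ring
  have hc := hsq (X * Y) (by rw [norm_mul, hX, hY, one_mul])
  have hs := hsq (X * star Y) (by rw [norm_mul, norm_star, hX, hY, one_mul])
  have hz := hsq Z hZ
  have h2 : √2 ^ 2 = 2 := Real.sq_sqrt zero_le_two
  rw [crossTerm] at h
  set c := (X * Y).re
  set s := (X * star Y).im
  have hdist : (√2 * Z.re + c) ^ 2 + (√2 * Z.im + s) ^ 2 = c ^ 2 + s ^ 2 - 2 := by
    linear_combination 2 * √2 * h + √2 ^ 2 * hz - h2
  have him : (X * Y).im = 0 := by nlinarith
  have hre : (X * star Y).re = 0 := by nlinarith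
  have hzre : √2 * Z.re = -c := by nlinarith
  have hzim : √2 * Z.im = -s := by nlinarith
  refine ⟨c, s, by rw [← hc, him]; ring, by rw [← hs, hre]; ring, ?_, ?_, ?_⟩
  · exact Complex.ext rfl (by simpa using him)
  · exact Complex.ext (by simpa using hre) (by simp [s])
  · exact Complex.ext (by simpa using hzre) (by simpa using hzim)

theorem eq_smul_star_and_sq_eq_of_crossTerm_eq {X Y Z : ℂ} (hX : ‖X‖ = 1) (hY : ‖Y‖ = 1)
    (hZ : ‖Z‖ = 1) (h : crossTerm X Y Z = -√2) :
    ∃ c t : ℝ, (c = 1 ∨ c = -1) ∧ (t = 1 ∨ t = -1) ∧ Y = c * star X ∧ X ^ 2 = t * Complex.I ∧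
      √2 * Z = -c * (1 + t * Complex.I) := by
  obtain ⟨c, s, hc, hs, hXY, hXY', hZ⟩ := mul_eq_and_mul_star_eq_of_crossTerm_eq hX hY hZ h
  have hunit : star X * X = 1 := by
    rw [Complex.star_def, Complex.conj_mul', hX, Complex.ofReal_one, one_pow]
  have hY' : Y = c * star X := by linear_combination star X * hXY - Y * hunit
  have hX' : c * X ^ 2 = s * Complex.I := by
    rw [← hXY', hY', star_mul', star_star, Complex.star_def, Complex.conj_ofReal]
    ring
  have hc' : (c : ℂ) ^ 2 = 1 := by exact_mod_cast hc
  have hcs : (c * s) ^ 2 = 1 := by rw [mul_pow, hc, hs, one_mul]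
  refine ⟨c, c * s, sq_eq_one_iff.1 hc, sq_eq_one_iff.1 hcs, hY', ?_, ?_⟩
  · push_cast
    linear_combination c * hX' - X ^ 2 * hc'
  · push_cast
    linear_combination hZ + s * Complex.I * hc'

theorem exists_phase_eq_of_crossTerm_eq {α β γ : ℂ} (hα : ‖α‖ = 1) (hβ : ‖β‖ = 1) (hγ : ‖γ‖ = 1)
    (h : crossTerm α β γ = -√2) : ∃ j, phase j = ![α, β, γ] := by
  obtain ⟨c, t, hc, ht, rfl, hsq, hγ⟩ := eq_smul_star_and_sq_eq_of_crossTerm_eq hα hβ hγ h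
  have hsqrt : (√2 : ℂ) ≠ 0 := by simp
  rw [phase_eq_of_ω]
  rcases ht with rfl | rfl
  · have hγω : γ = -c * ω := mul_left_cancel₀ hsqrt (by
      rw [hγ, mul_left_comm, sqrt_two_mul_ω, Complex.ofReal_one, one_mul])
    have hαω : α ^ 2 = ω ^ 2 := by rw [hsq, ω_sq, Complex.ofReal_one, one_mul]
    rcases sq_eq_sq_iff_eq_or_eq_neg.1 hαω with rfl | rfl <;> rcases hc with rfl | rfl
    · exact ⟨6, by simp [hγω, star_ω, -RCLike.star_def]⟩
    · exact ⟨7, by simp [hγω, star_ω, -RCLike.star_def]⟩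
    · exact ⟨5, by simp [hγω, star_ω, -RCLike.star_def]⟩
    · exact ⟨4, by simp [hγω, star_ω, -RCLike.star_def]⟩
  · have hγω : γ = c * ω ^ 3 := mul_left_cancel₀ hsqrt (by
      rw [hγ, mul_left_comm, sqrt_two_mul_ω_pow_three]
      push_cast
      ring)
    have hαω : α ^ 2 = (ω ^ 3) ^ 2 := by
      rw [hsq, ← ω_sq]
      push_cast
      linear_combination -ω ^ 2 * ω_pow_four
    rcases sq_eq_sq_iff_eq_or_eq_neg.1 hαω with rfl | rfl <;> rcases hc with rfl | rfl
    · exact ⟨1, by simp [hγω, star_ω_pow_three, -star_pow, -RCLike.star_def]⟩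
    · exact ⟨0, by simp [hγω, star_ω_pow_three, -star_pow, -RCLike.star_def]⟩
    · exact ⟨2, by simp [hγω, star_ω_pow_three, -star_pow, -RCLike.star_def]⟩
    · exact ⟨3, by simp [hγω, star_ω_pow_three, -star_pow, -RCLike.star_def]⟩

theorem norm_phase (j : Fin 8) (k : Fin 3) : ‖phase j k‖ = 1 := by
  have hω : ‖ω‖ = 1 := by
    refine (pow_eq_one_iff_of_nonneg (norm_nonneg _) four_ne_zero).1 ?_
    rw [← norm_pow, ω_pow_four, norm_neg, norm_one]
  rw [phase_eq_of_ω]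
  fin_cases j <;> fin_cases k <;> simp [hω]

theorem crossTerm_star (X Y Z : ℂ) : crossTerm (star X) (star Y) (star Z) = crossTerm X Y Z := by
  simp only [crossTerm, Complex.star_def, Complex.mul_re, Complex.mul_im, Complex.conj_re,
    Complex.conj_im]
  ring

theorem crossTerm_kleinSign_smul (j : Fin 4) (X Y Z : ℂ) :
    crossTerm (kleinSign j 1 • X) (kleinSign j 2 • Y) (kleinSign j 3 • Z) = crossTerm X Y Z := by
  fin_cases j <;> simp [crossTerm, kleinSign] <;> ring

theorem crossTerm_signedTriple (a : Fin 3 → ℂ) (j : Fin 8) :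
    crossTerm (signedTriple a j 0) (signedTriple a j 1) (signedTriple a j 2) =
      crossTerm (a 0) (a 1) (a 2) := by
  induction j using Fin.addCases (m := 4) (n := 4) with
  | left j =>
    simp only [signedTriple, Fin.append_left]
    exact crossTerm_kleinSign_smul j _ _ _
  | right j =>
    simp only [signedTriple, Fin.append_right]
    exact (crossTerm_kleinSign_smul j _ _ _).trans (crossTerm_star _ _ _)

theorem crossTerm_phase (j : Fin 8) :
    crossTerm (phase j 0) (phase j 1) (phase j 2) = -√2 := by
  have hprod : ω ^ 3 * ω = -1 := by rw [← pow_succ, ω_pow_four]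
  have hprod' : ω ^ 3 * star ω = Complex.I := by
    rw [star_ω, ← ω_sq]
    linear_combination -ω ^ 2 * ω_pow_four
  have hre : √2 * (ω ^ 3).re = -1 := by
    simpa using congrArg Complex.re sqrt_two_mul_ω_pow_three
  have him : √2 * (ω ^ 3).im = 1 := by
    simpa using congrArg Complex.im sqrt_two_mul_ω_pow_three
  rw [phase_eq_signedTriple, crossTerm_signedTriple, crossTerm]
  simp only [Matrix.cons_val, ω_pow_seven, hprod, hprod', Complex.neg_re, Complex.neg_im,
    Complex.one_re, Complex.I_im]
  refine mul_left_cancel₀ (Real.sqrt_pos.2 zero_lt_two).ne' ?_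
  linear_combination hre - him + Real.sq_sqrt zero_le_two

end Phases

section Zeros

variable {b : Idx} {x y z : Fin 2 → ℂ}

theorem opp_ne (i : Idx) : opp i ≠ i := by
  revert i
  decide

theorem exists_ne_and_ne_opp (i : Idx) : ∃ k, k ≠ i ∧ k ≠ opp i := by
  revert i
  decide

theorem eq_of_forall_add_add_eq {f g h : Fin 2 → ℝ}
    (H : ∀ i, i ≠ b → i ≠ opp b →
      f i.1 + g i.2.1 + h i.2.2 = f (opp i).1 + g (opp i).2.1 + h (opp i).2.2) :
    f 0 = f 1 ∧ g 0 = g 1 ∧ h 0 = h 1 := by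
  have h0 := H (0, 0, 0)
  have h1 := H (0, 0, 1)
  have h2 := H (0, 1, 0)
  have h3 := H (0, 1, 1)
  obtain ⟨b₀, b₁, b₂⟩ := b
  fin_cases b₀ <;> fin_cases b₁ <;> fin_cases b₂ <;> simp [opp] at h0 h1 h2 h3 <;>
    refine ⟨?_, ?_, ?_⟩ <;> linarith

theorem norm_eq_of_norm_prodVec_eq (hx : ∀ k, x k ≠ 0) (hy : ∀ k, y k ≠ 0) (hz : ∀ k, z k ≠ 0)
    (h : ∀ i, i ≠ b → i ≠ opp b → ‖prodVec x y z i‖ = ‖prodVec x y z (opp i)‖) :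
    ‖x 0‖ = ‖x 1‖ ∧ ‖y 0‖ = ‖y 1‖ ∧ ‖z 0‖ = ‖z 1‖ := by
  have hlog (i : Idx) : Real.log ‖prodVec x y z i‖ =
      Real.log ‖x i.1‖ + Real.log ‖y i.2.1‖ + Real.log ‖z i.2.2‖ := by
    rw [prodVec, norm_mul, norm_mul, Real.log_mul (by simp [hx, hy]) (by simp [hz]),
      Real.log_mul (by simp [hx]) (by simp [hy])]
  have hinj {v : Fin 2 → ℂ} (hv : ∀ k, v k ≠ 0) (h : Real.log ‖v 0‖ = Real.log ‖v 1‖) :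
      ‖v 0‖ = ‖v 1‖ := Real.log_injOn_pos (norm_pos_iff.2 (hv 0)) (norm_pos_iff.2 (hv 1)) h
  obtain ⟨h₀, h₁, h₂⟩ := eq_of_forall_add_add_eq (f := fun k => Real.log ‖x k‖)
    (g := fun k => Real.log ‖y k‖) (h := fun k => Real.log ‖z k‖) fun i hi hi' => by
      rw [← hlog, ← hlog, h i hi hi']
  exact ⟨hinj hx h₀, hinj hy h₁, hinj hz h₂⟩

theorem crossTerm_real_mul (s t u : ℝ) (X Y Z : ℂ) :
    crossTerm (s * X) (t * Y) (u * Z) = s * t * u * crossTerm X Y Z := by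
  simp only [crossTerm, star_mul', Complex.star_def, Complex.conj_ofReal, Complex.mul_re,
    Complex.mul_im, Complex.ofReal_re, Complex.ofReal_im]
  ring

theorem mul_star_eq_norm_sq_mul_star_div {v w : ℂ} (hv : v ≠ 0) :
    v * star w = (‖v‖ ^ 2 : ℝ) * star (w / v) := by
  rw [star_div₀, Complex.ofReal_pow, ← Complex.mul_conj']
  rw [mul_assoc, ← Complex.star_def, mul_div_cancel₀ _ (star_ne_zero.2 hv)]

theorem prodVec_eq_smul_phaseVec (hx : x 0 ≠ 0) (hy : y 0 ≠ 0) (hz : z 0 ≠ 0) :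
    prodVec x y z = (x 0 * y 0 * z 0) • phaseVec ![x 1 / x 0, y 1 / y 0, z 1 / z 0] := by
  have hbit {v : Fin 2 → ℂ} (hv : v 0 ≠ 0) (k : Fin 2) : v k = v 0 * ![1, v 1 / v 0] k := by
    fin_cases k
    · simp
    · exact (mul_div_cancel₀ _ hv).symm
  funext i
  simp only [prodVec, phaseVec, Pi.smul_apply, smul_eq_mul, Matrix.cons_val]
  rw [hbit hx i.1, hbit hy i.2.1, hbit hz i.2.2]
  ring

theorem exists_eq_smul_phaseVec (hx : ∀ k, x k ≠ 0) (hy : ∀ k, y k ≠ 0) (hz : ∀ k, z k ≠ 0)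
    (h : witnessForm b (prodVec x y z) = 0) :
    ∃ (j : Fin 8) (c : ℂ), prodVec x y z = c • phaseVec (phase j) := by
  obtain ⟨hnorm, hcross⟩ := witnessForm_prodVec_eq_zero_iff.1 h
  obtain ⟨hx', hy', hz'⟩ := norm_eq_of_norm_prodVec_eq hx hy hz hnorm
  have hunit {v : Fin 2 → ℂ} (hv : ∀ k, v k ≠ 0) (h : ‖v 0‖ = ‖v 1‖) : ‖v 1 / v 0‖ = 1 := by
    rw [norm_div, h, div_self (norm_ne_zero_iff.2 (hv 1))]
  have hcross' : crossTerm (x 1 / x 0) (y 1 / y 0) (z 1 / z 0) = -√2 := by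
    rw [mul_star_eq_norm_sq_mul_star_div (hx 0), mul_star_eq_norm_sq_mul_star_div (hy 0),
      mul_star_eq_norm_sq_mul_star_div (hz 0), crossTerm_real_mul, crossTerm_star] at hcross
    simp only [norm_mul, norm_star, hunit hx hx', hunit hy hy', hunit hz hz', mul_one,
      Complex.norm_real, norm_pow, norm_norm] at hcross
    have hpos : ‖x 0‖ ^ 2 * ‖y 0‖ ^ 2 * ‖z 0‖ ^ 2 ≠ 0 := by simp [hx, hy, hz]
    exact mul_left_cancel₀ hpos (hcross.trans (by ring))
  obtain ⟨j, hj⟩ := exists_phase_eq_of_crossTerm_eq (hunit hx hx') (hunit hy hy') (hunit hz hz')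
    hcross'
  exact ⟨j, _, hj ▸ prodVec_eq_smul_phaseVec (hx 0) (hy 0) (hz 0)⟩

theorem exists_eq_smul_single {N : Idx → ℂ} (hb : N b * N (opp b) = 0)
    (h : ∀ i, i ≠ b → i ≠ opp b → N i = 0) :
    ∃ k ∈ ({b, opp b} : Set Idx), ∃ c : ℂ, N = c • Pi.single k 1 := by
  rcases mul_eq_zero.1 hb with hb | hb
  · refine ⟨opp b, Or.inr rfl, N (opp b), funext fun i => ?_⟩
    by_cases hi : i = opp b
    · simp [hi]
    · by_cases hi' : i = b
      · simp [hi', hb, (opp_ne b).symm]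
      · simp [hi, h i hi' hi]
  · refine ⟨b, Or.inl rfl, N b, funext fun i => ?_⟩
    by_cases hi : i = b
    · simp [hi]
    · by_cases hi' : i = opp b
      · simp [hi', hb, opp_ne b]
      · simp [hi, h i hi hi']

/-- The zeros of `witnessForm b` on product vectors, one on each line: `|b⟩`, `|opp b⟩` and the
eight product vectors with entries of modulus one given by the phase triples. -/
noncomputable def vertexVec (b : Idx) : Fin 10 → Idx → ℂ :=
  Fin.append (m := 2) (n := 8) ![Pi.single b 1, Pi.single (opp b) 1] fun j => phaseVec (phase j)

theorem range_vertexVec (b : Idx) : Set.range (vertexVec b) =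
    {Pi.single b 1, Pi.single (opp b) 1} ∪ Set.range fun j => phaseVec (phase j) := by
  have hsum : vertexVec b ∘ finSumFinEquiv =
      Sum.elim ![Pi.single b 1, Pi.single (opp b) 1] fun j => phaseVec (phase j) :=
    Fin.append_comp_sumElim
  rw [← (finSumFinEquiv (m := 2) (n := 8)).surjective.range_comp (vertexVec b), hsum,
    Set.Sum.elim_range, Matrix.range_cons_cons_empty]

theorem exists_eq_smul_vertexVec (h : witnessForm b (prodVec x y z) = 0) :
    ∃ v ∈ Set.range (vertexVec b), ∃ c : ℂ, prodVec x y z = c • v := by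
  rw [range_vertexVec]
  by_cases hne : ∀ i, prodVec x y z i ≠ 0
  · have hx (k : Fin 2) : x k ≠ 0 := left_ne_zero_of_mul (left_ne_zero_of_mul (hne (k, 0, 0)))
    have hy (k : Fin 2) : y k ≠ 0 := right_ne_zero_of_mul (left_ne_zero_of_mul (hne (0, k, 0)))
    have hz (k : Fin 2) : z k ≠ 0 := right_ne_zero_of_mul (hne (0, 0, k))
    obtain ⟨j, c, hc⟩ := exists_eq_smul_phaseVec hx hy hz h
    exact ⟨_, Or.inr ⟨j, rfl⟩, c, hc⟩
  · push Not at hne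
    obtain ⟨i₀, hi₀⟩ := hne
    have hzero (i : Idx) : prodVec x y z i * prodVec x y z (opp i) = 0 := by
      rw [← norm_eq_zero, norm_mul, norm_prodVec_mul_norm_prodVec_opp,
        ← norm_prodVec_mul_norm_prodVec_opp x y z i₀, hi₀, norm_zero, zero_mul]
    obtain ⟨k, hk, c, hc⟩ := exists_eq_smul_single (hzero b) fun i hi hi' => by
      have hnorm := (witnessForm_prodVec_eq_zero_iff.1 h).1 i hi hi'
      rcases mul_eq_zero.1 (hzero i) with h0 | h0
      · exact h0
      · rwa [h0, norm_zero, norm_eq_zero] at hnorm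
    exact ⟨_, Or.inl (hk.imp (congrArg (Pi.single · 1)) (congrArg (Pi.single · 1))), c, hc⟩

theorem witnessForm_single (b k : Idx) :
    witnessForm b (Pi.single k 1) = if k = b ∨ k = opp b then 0 else √8 := by
  have hanti (i : Idx) :
      (Pi.single k 1 : Idx → ℂ) i * star ((Pi.single k 1 : Idx → ℂ) (opp i)) = 0 := by
    by_cases hi : i = k
    · simp [hi, opp_ne]
    · simp [hi]
  have hdiag (i : Idx) : ‖(Pi.single k 1 : Idx → ℂ) i‖ ^ 2 = if i = k then 1 else 0 := by
    rw [Pi.single_apply]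
    split_ifs <;> simp
  simp only [witnessForm, hanti, hdiag, Finset.sum_ite_eq', Complex.zero_re, mul_zero,
    Finset.sum_const_zero, add_zero, Finset.mem_compl, Finset.mem_insert, Finset.mem_singleton]
  split_ifs <;> simp_all

theorem norm_phaseVec_phase (j : Fin 8) (i : Idx) : ‖phaseVec (phase j) i‖ = 1 := by
  have hbit (k : Fin 3) (l : Fin 2) : ‖(![1, phase j k] : Fin 2 → ℂ) l‖ = 1 := by
    fin_cases l
    exacts [norm_one, norm_phase j k]
  rw [phaseVec, prodVec, norm_mul, norm_mul, hbit, hbit, hbit, mul_one, mul_one]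

theorem witnessForm_phaseVec_phase (b : Idx) (j : Fin 8) :
    witnessForm b (phaseVec (phase j)) = 0 := by
  refine witnessForm_prodVec_eq_zero_iff.2 ⟨fun i _ _ => ?_, ?_⟩
  · exact (norm_phaseVec_phase j i).trans (norm_phaseVec_phase j (opp i)).symm
  · simp only [Matrix.cons_val, one_mul, crossTerm_star, crossTerm_phase, norm_star, norm_phase,
      mul_one]

end Zeros

section Vertices

variable {p q r : ℝ} {b : Idx}

theorem forall_vertexVec {P : (Idx → ℂ) → Prop} :
    (∀ i, P (vertexVec b i)) ↔
      P (Pi.single b 1) ∧ P (Pi.single (opp b) 1) ∧ ∀ j, P (phaseVec (phase j)) := by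
  rw [← Set.forall_mem_range, range_vertexVec]
  simp only [Set.mem_union, or_imp, forall_and, Set.mem_insert_iff, Set.mem_singleton_iff,
    forall_eq, Set.forall_mem_range, and_assoc]

theorem exists_prodVec_eq_vertexVec (b : Idx) (i : Fin 10) :
    ∃ x y z, prodVec x y z = vertexVec b i := by
  revert i
  rw [forall_vertexVec (P := fun v => ∃ x y z, prodVec x y z = v)]
  exact ⟨⟨_, _, _, prodVec_single b⟩, ⟨_, _, _, prodVec_single (opp b)⟩, fun j => ⟨_, _, _, rfl⟩⟩

theorem vertexVec_ne_zero (b : Idx) (i : Fin 10) : vertexVec b i ≠ 0 := by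
  revert i
  rw [forall_vertexVec (P := (· ≠ 0))]
  refine ⟨by simp, by simp, fun j h => ?_⟩
  simpa [phaseVec, prodVec] using congrFun h (0, 0, 0)

theorem witnessForm_vertexVec (b : Idx) (i : Fin 10) : witnessForm b (vertexVec b i) = 0 := by
  revert i
  rw [forall_vertexVec (P := (witnessForm b · = 0))]
  exact ⟨by simp [witnessForm_single], by simp [witnessForm_single], witnessForm_phaseVec_phase b⟩

/-- The extreme points of the dual face of `xWitness p q r b`. -/
noncomputable def vertex (p q r : ℝ) (b : Idx) (i : Fin 10) : Mat :=
  pureState (weightVec p q r * vertexVec b i)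

theorem weightVec_mul_single (p q r : ℝ) (i : Idx) :
    weightVec p q r * Pi.single i 1 = (weight p q r i : ℂ) • Pi.single i 1 := by
  rw [← weightVec_apply]
  ext k
  by_cases hk : k = i
  · simp [hk]
  · simp [hk]

theorem pureState_weightVec_mul_single (hp : 0 < p) (hq : 0 < q) (hr : 0 < r) (i : Idx) :
    pureState (weightVec p q r * Pi.single i 1) = pureState (Pi.single i 1) := by
  rw [weightVec_mul_single, pureState_smul (Complex.ofReal_ne_zero.2 (weight_pos hp hq hr i).ne')]

theorem eta_eq_smul (p q r : ℝ) (j : Fin 8) :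
    eta p q r j = (((√(p * q * r))⁻¹ : ℝ) : ℂ) • (weightVec p q r * phaseVec (phase j)) := by
  have hbit (s : ℝ) (a : ℂ) : (![(s : ℂ), a] : Fin 2 → ℂ) = ![(s : ℂ), 1] * ![1, a] := by
    funext k
    fin_cases k <;> simp
  rw [eta, hbit p, hbit q, hbit r, prodVec_mul, Complex.coe_smul]
  rfl

theorem range_vertex (hp : 0 < p) (hq : 0 < q) (hr : 0 < r) (b : Idx) :
    Set.range (vertex p q r b) = {pureState (Pi.single b 1), pureState (Pi.single (opp b) 1)} ∪
      Set.range fun j => pureState (eta p q r j) := by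
  have heta (j : Fin 8) :
      pureState (eta p q r j) = pureState (weightVec p q r * phaseVec (phase j)) := by
    rw [eta_eq_smul, pureState_smul]
    exact Complex.ofReal_ne_zero.2 (inv_pos.2 (Real.sqrt_pos.2 (by positivity))).ne'
  change Set.range ((fun v => pureState (weightVec p q r * v)) ∘ vertexVec b) = _
  rw [Set.range_comp, range_vertexVec, Set.image_union, Set.image_pair,
    pureState_weightVec_mul_single hp hq hr, pureState_weightVec_mul_single hp hq hr,
    ← Set.range_comp]
  simp only [heta, Function.comp_def]

theorem weightVec_mul_ne_zero (hp : 0 < p) (hq : 0 < q) (hr : 0 < r) {ζ : Idx → ℂ} (hζ : ζ ≠ 0) :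
    weightVec p q r * ζ ≠ 0 := by
  obtain ⟨i, hi⟩ := Function.ne_iff.1 hζ
  refine Function.ne_iff.2 ⟨i, mul_ne_zero ?_ hi⟩
  rw [weightVec_apply]
  exact Complex.ofReal_ne_zero.2 (weight_pos hp hq hr i).ne'

theorem vertex_mem_pureProductStates (hp : 0 < p) (hq : 0 < q) (hr : 0 < r) (b : Idx)
    (i : Fin 10) : vertex p q r b i ∈ pureProductStates := by
  have hne := weightVec_mul_ne_zero hp hq hr (vertexVec_ne_zero b i)
  obtain ⟨x, y, z, hxyz⟩ := exists_prodVec_eq_vertexVec b i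
  rw [vertex, ← hxyz, weightVec, ← prodVec_mul]
  refine pureState_prodVec_mem ?_
  rwa [prodVec_mul, hxyz]

theorem exists_pureState_weightVec_mul_eq (hp : 0 < p) (hq : 0 < q) (hr : 0 < r) {P : Mat}
    (hP : P ∈ pureProductStates) :
    ∃ x y z, prodVec x y z ≠ 0 ∧ pureState (weightVec p q r * prodVec x y z) = P := by
  obtain ⟨x, y, z, hunit, rfl⟩ := hP
  have hbit {s : ℝ} (hs : 0 < s) (v : Fin 2 → ℂ) : ∃ v', ![(s : ℂ), 1] * v' = v := by
    refine ⟨v / ![(s : ℂ), 1], funext fun k => mul_div_cancel₀ _ ?_⟩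
    fin_cases k
    exacts [Complex.ofReal_ne_zero.2 hs.ne', one_ne_zero]
  obtain ⟨x, rfl⟩ := hbit hp x
  obtain ⟨y, rfl⟩ := hbit hq y
  obtain ⟨z, rfl⟩ := hbit hr z
  rw [← pureState_of_unit hunit]
  rw [prodVec_mul, ← weightVec] at hunit ⊢
  refine ⟨x, y, z, fun h => ?_, rfl⟩
  simp [h] at hunit

theorem exists_pos_pairingRe_pureState_eq_mul (hp : 0 < p) (hq : 0 < q) (hr : 0 < r) (b : Idx)
    {ζ : Idx → ℂ} (hζ : ζ ≠ 0) :
    ∃ t > 0, pairingRe (xWitness p q r b) (pureState (weightVec p q r * ζ)) =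
      t * witnessForm b ζ := by
  obtain ⟨t, ht, htζ⟩ := exists_pos_pureState_eq_smul (weightVec_mul_ne_zero hp hq hr hζ)
  refine ⟨t * (p * q * r), by positivity, ?_⟩
  rw [htζ, map_smul, pairingRe_xWitness_vecMulVec hp hq hr, smul_eq_mul, ← mul_assoc t]

theorem pairingRe_xWitness_nonneg (hp : 0 < p) (hq : 0 < q) (hr : 0 < r) (b : Idx) :
    ∀ P ∈ pureProductStates, 0 ≤ pairingRe (xWitness p q r b) P := by
  intro P hP
  obtain ⟨x, y, z, hne, rfl⟩ := exists_pureState_weightVec_mul_eq hp hq hr hP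
  obtain ⟨t, ht, h⟩ := exists_pos_pairingRe_pureState_eq_mul hp hq hr b hne
  exact h ▸ mul_nonneg ht.le (witnessForm_prodVec_nonneg x y z b)

theorem sep_pairingRe_xWitness_eq_zero (hp : 0 < p) (hq : 0 < q) (hr : 0 < r) (b : Idx) :
    {P ∈ pureProductStates | pairingRe (xWitness p q r b) P = 0} =
      Set.range (vertex p q r b) := by
  refine Set.Subset.antisymm ?_ ?_
  · rintro P ⟨hP, hzero⟩
    obtain ⟨x, y, z, hne, rfl⟩ := exists_pureState_weightVec_mul_eq hp hq hr hP
    obtain ⟨t, ht, h⟩ := exists_pos_pairingRe_pureState_eq_mul hp hq hr b hne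
    have hform := (mul_eq_zero.1 (h.symm.trans hzero)).resolve_left ht.ne'
    obtain ⟨_, ⟨i, rfl⟩, c, hc⟩ := exists_eq_smul_vertexVec hform
    have hc0 : c ≠ 0 := by
      rintro rfl
      exact hne (hc.trans (zero_smul ℂ _))
    exact ⟨i, by rw [vertex, hc, mul_smul_comm, pureState_smul hc0]⟩
  · rintro _ ⟨i, rfl⟩
    obtain ⟨t, -, h⟩ :=
      exists_pos_pairingRe_pureState_eq_mul hp hq hr b (vertexVec_ne_zero b i)
    exact ⟨vertex_mem_pureProductStates hp hq hr b i,
      h.trans (by rw [witnessForm_vertexVec, mul_zero])⟩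

theorem isHermitian_xWitness (p q r : ℝ) (b : Idx) : (xWitness p q r b).IsHermitian :=
  isHermitian_xMatrix _ fun i => by rw [Pi.smul_apply, Pi.smul_apply, antiSign_opp]

theorem dualFace_xWitness (hp : 0 < p) (hq : 0 < q) (hr : 0 < r) (b : Idx) :
    dualFace (xWitness p q r b) = convexHull ℝ (Set.range (vertex p q r b)) := by
  rw [dualFace_eq_sep_pairingRe (isHermitian_xWitness p q r b), separableStates,
    convexHull_sep_map_eq_zero (pairingRe_xWitness_nonneg hp hq hr b),
    sep_pairingRe_xWitness_eq_zero hp hq hr]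

end Vertices

section LinearIndependence

variable {a : Fin 3 → ℂ} {p q r : ℝ} {b : Idx}

theorem eq_zero_of_mul_add_mul_star_eq_zero {x y m n : ℂ} (hm : m ^ 4 = -1) (hn : n ^ 4 = 1)
    (hxm : x * m + y * star m = 0) (hxn : x * n + y * star n = 0) : x = 0 ∧ y = 0 := by
  have hdet : m * star n - star m * n ≠ 0 := by
    intro h
    have hreal : star (m * star n) = m * star n := by
      rw [star_mul', star_star, ← sub_eq_zero.1 h]
    obtain ⟨s, hs⟩ := Complex.conj_eq_iff_real.1 hreal
    have hs4 : s ^ 4 = -1 := by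
      have : (s : ℂ) ^ 4 = -1 := by rw [← hs, mul_pow, ← star_pow, hm, hn, star_one, mul_one]
      exact_mod_cast this
    nlinarith [sq_nonneg (s ^ 2)]
  constructor
  · refine (mul_eq_zero.1 ?_).resolve_right hdet
    linear_combination star n * hxm - star m * hxn
  · refine (mul_eq_zero.1 ?_).resolve_right hdet
    linear_combination m * hxn - n * hxm

theorem phaseVec_pow_four (ha : ∀ k, a k ^ 4 = -1) (l : Fin 4) :
    phaseVec a (oddLabel l) ^ 4 = -1 ∧ phaseVec a (opp (oddLabel l)) ^ 4 = 1 := by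
  fin_cases l <;> simp [phaseVec, prodVec, oddLabel, opp, mul_pow, ha]

theorem phaseVec_star (a : Fin 3 → ℂ) (i : Idx) :
    phaseVec (fun k => star (a k)) i = star (phaseVec a i) := by
  have hbit (s : ℂ) (k : Fin 2) : (![1, star s] : Fin 2 → ℂ) k = star (![1, s] k) := by
    fin_cases k
    exacts [star_one ℂ |>.symm, rfl]
  simp only [phaseVec, prodVec, hbit, star_mul']

theorem kleinSign_comm (j l : Fin 4) : kleinSign j l = kleinSign l j := by
  fin_cases j <;> fin_cases l <;> rfl

theorem sum_smul_phaseVec_kleinSign_smul (a : Fin 3 → ℂ) (g : Fin 4 → ℂ) (l : Fin 4) {i : Idx}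
    (hi : i = oddLabel l ∨ i = opp (oddLabel l)) :
    ∑ j, g j * phaseVec (fun k => kleinSign j k.succ • a k) i =
      (∑ j, kleinSign l j • g j) * phaseVec a i := by
  rw [Finset.sum_mul]
  refine Finset.sum_congr rfl fun j _ => ?_
  have hsign : phaseVec (fun k => kleinSign j k.succ • a k) i = kleinSign j l • phaseVec a i := by
    rcases hi with rfl | rfl
    exacts [(phaseVec_kleinSign_smul a j l).1, (phaseVec_kleinSign_smul a j l).2]
  rw [hsign, kleinSign_comm, mul_smul_comm, smul_mul_assoc]

/- Orthogonality of characters reduces the claim to the `2 × 2` systems on the pairs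
`{i, opp i}`. -/
theorem linearIndependent_phaseVec_signedTriple (ha : ∀ k, a k ^ 4 = -1) :
    LinearIndependent ℂ fun j => phaseVec (signedTriple a j) := by
  refine Fintype.linearIndependent_iff.2 fun g hg => ?_
  have hpair (l : Fin 4) {i : Idx} (hi : i = oddLabel l ∨ i = opp (oddLabel l)) :
      (∑ j, kleinSign l j • g (Fin.castAdd 4 j)) * phaseVec a i +
        (∑ j, kleinSign l j • g (Fin.natAdd 4 j)) * star (phaseVec a i) = 0 := by
    rw [← phaseVec_star, ← sum_smul_phaseVec_kleinSign_smul a _ l hi,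
      ← sum_smul_phaseVec_kleinSign_smul _ _ l hi]
    have hgi := congrFun hg i
    rw [Finset.sum_apply] at hgi
    have hsplit := (Fin.sum_univ_add (a := 4) (b := 4) _).symm.trans hgi
    simpa only [signedTriple, Fin.append_left, Fin.append_right, Pi.smul_apply, smul_eq_mul,
      Pi.zero_apply] using hsplit
  have hzero (l : Fin 4) := eq_zero_of_mul_add_mul_star_eq_zero (phaseVec_pow_four ha l).1
    (phaseVec_pow_four ha l).2 (hpair l (Or.inl rfl)) (hpair l (Or.inr rfl))
  exact (Fin.forall_fin_add (m := 4) (n := 4) (g · = 0)).2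
    ⟨congrFun (eq_zero_of_sum_kleinSign_smul fun l => (hzero l).1),
      congrFun (eq_zero_of_sum_kleinSign_smul fun l => (hzero l).2)⟩

theorem linearIndependent_weightVec_mul_phaseVec (hp : 0 < p) (hq : 0 < q) (hr : 0 < r)
    (ha : ∀ k, a k ^ 4 = -1) :
    LinearIndependent ℂ fun j => weightVec p q r * phaseVec (signedTriple a j) := by
  have hunit : IsUnit (weightVec p q r) := Pi.isUnit_iff.2 fun i => by
    rw [weightVec_apply, isUnit_iff_ne_zero]
    exact Complex.ofReal_ne_zero.2 (weight_pos hp hq hr i).ne'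
  exact (linearIndependent_phaseVec_signedTriple ha).map' (LinearMap.mulLeft ℂ _)
    (LinearMap.ker_eq_bot.2 hunit.mul_right_injective)

theorem base_phase_pow_four (k : Fin 3) : (![ω ^ 3, ω, ω ^ 7] : Fin 3 → ℂ) k ^ 4 = -1 := by
  fin_cases k
  · change (ω ^ 3) ^ 4 = -1
    linear_combination (ω ^ 8 - ω ^ 4 + 1) * ω_pow_four
  · exact ω_pow_four
  · change (ω ^ 7) ^ 4 = -1
    rw [← pow_mul, mul_comm, pow_mul, ω_pow_four]
    norm_num

theorem pureState_single (i : Idx) : pureState (Pi.single i 1) = Matrix.single i i 1 := by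
  ext k l
  by_cases hk : k = i <;> by_cases hl : l = i <;>
    simp [pureState, Matrix.vecMulVec_apply, hk, hl, Ne.symm]

theorem vertex_castAdd (hp : 0 < p) (hq : 0 < q) (hr : 0 < r) (b : Idx) (j : Fin 2) :
    vertex p q r b (Fin.castAdd 8 j) = Matrix.single (![b, opp b] j) (![b, opp b] j) 1 := by
  rw [vertex, vertexVec, Fin.append_left, ← pureState_single,
    ← pureState_weightVec_mul_single hp hq hr]
  fin_cases j <;> rfl

theorem vertex_natAdd (p q r : ℝ) (b : Idx) (j : Fin 8) :
    vertex p q r b (Fin.natAdd 2 j) = pureState (weightVec p q r * phaseVec (phase j)) := by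
  rw [vertex, vertexVec, Fin.append_right]

theorem exists_vertex_natAdd_apply_eq (hp : 0 < p) (hq : 0 < q) (hr : 0 < r) (b : Idx) (j : Fin 8)
    (k : Idx) : ∃ c ≠ 0, ∀ i, vertex p q r b (Fin.natAdd 2 j) i k =
      c * (weightVec p q r * phaseVec (phase j)) i := by
  set v := weightVec p q r * phaseVec (phase j)
  have hv (i : Idx) : v i ≠ 0 := by
    refine mul_ne_zero ?_ (norm_ne_zero_iff.1 (norm_phaseVec_phase j i ▸ one_ne_zero))
    rw [weightVec_apply]
    exact Complex.ofReal_ne_zero.2 (weight_pos hp hq hr i).ne'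
  refine ⟨(star v ⬝ᵥ v)⁻¹ * star (v k), mul_ne_zero (inv_ne_zero ?_) (star_ne_zero.2 (hv k)),
    fun i => ?_⟩
  · exact (Matrix.dotProduct_star_self_pos_iff.2 fun h => hv k (congrFun h k)).ne'
  · rw [vertex_natAdd, pureState, Matrix.smul_apply, Matrix.vecMulVec_apply, Pi.star_apply,
      smul_eq_mul, mul_assoc, mul_comm (v i)]

/- The column at a label outside `{b, opp b}` only sees the eight vertices given by the phases. -/
theorem linearIndependent_vertex (hp : 0 < p) (hq : 0 < q) (hr : 0 < r) (b : Idx) :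
    LinearIndependent ℝ (vertex p q r b) := by
  refine Fintype.linearIndependent_iff.2 fun g hg => ?_
  have hentry (i k : Idx) :
      ∑ j : Fin 2, g (Fin.castAdd 8 j) • vertex p q r b (Fin.castAdd 8 j) i k +
      ∑ j : Fin 8, g (Fin.natAdd 2 j) • vertex p q r b (Fin.natAdd 2 j) i k = 0 := by
    have hik := congrFun (congrFun hg i) k
    rw [Matrix.sum_apply] at hik
    exact (Fin.sum_univ_add (a := 2) (b := 8) _).symm.trans hik
  have hphase (j : Fin 8) : g (Fin.natAdd 2 j) = 0 := by
    obtain ⟨k, hk, hk'⟩ := exists_ne_and_ne_opp b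
    choose c hc hcol using fun j => exists_vertex_natAdd_apply_eq hp hq hr b j k
    have hlin := linearIndependent_weightVec_mul_phaseVec hp hq hr base_phase_pow_four
    rw [← phase_eq_signedTriple, Fintype.linearIndependent_iff] at hlin
    have hgc := hlin (fun j => g (Fin.natAdd 2 j) * c j) (funext fun i => ?_) j
    · exact Complex.ofReal_eq_zero.1 ((mul_eq_zero.1 hgc).resolve_right (hc j))
    · have hik := hentry i k
      simp only [hcol, vertex_castAdd hp hq hr, Fin.sum_univ_two] at hik
      simpa [Matrix.single_apply, hk.symm, hk'.symm, Finset.sum_apply, mul_assoc] using hik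
  have hsingle (k : Idx) := hentry k k
  simp only [hphase, vertex_castAdd hp hq hr, zero_smul, Finset.sum_const_zero, add_zero,
    Fin.sum_univ_two] at hsingle
  refine (Fin.forall_fin_add (m := 2) (n := 8) (g · = 0)).2 ⟨Fin.forall_fin_two.2 ⟨?_, ?_⟩, hphase⟩
  · simpa [opp_ne, (opp_ne b).symm] using hsingle b
  · simpa [opp_ne, (opp_ne b).symm] using hsingle (opp b)

end LinearIndependence

section FullRank

variable {p q r : ℝ} {b : Idx}

/-- Conjugation of the data `x` of party `k`, provided that `k` belongs to `S`. It describes the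
partial transpose of a pure product state. -/
def conjOn {R : Type*} [Star R] (S : Finset (Fin 3)) (k : Fin 3) (x : R) : R :=
  if k ∈ S then star x else x

theorem partialTranspose_vecMulVec (S : Finset (Fin 3)) (x y z : Fin 2 → ℂ) :
    partialTranspose S (Matrix.vecMulVec (prodVec x y z) (star (prodVec x y z))) =
      Matrix.vecMulVec (prodVec (conjOn S 0 x) (conjOn S 1 y) (conjOn S 2 z))
        (star (prodVec (conjOn S 0 x) (conjOn S 1 y) (conjOn S 2 z))) := by
  ext i j
  simp only [partialTranspose, Matrix.of_apply, Matrix.vecMulVec_apply, Pi.star_apply, prodVec,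
    conjOn, star_mul']
  split_ifs <;> simp only [Pi.star_apply, star_star] <;> ring

theorem posSemidef_partialTranspose (S : Finset (Fin 3)) {P : Mat} (hP : P ∈ pureProductStates) :
    (partialTranspose S P).PosSemidef := by
  obtain ⟨x, y, z, -, rfl⟩ := hP
  rw [partialTranspose_vecMulVec]
  exact Matrix.posSemidef_vecMulVec_self_star _

theorem partialTranspose_sum_smul {ι : Type*} (S : Finset (Fin 3)) (T : Finset ι) (c : ι → ℝ)
    (M : ι → Mat) :
    partialTranspose S (∑ i ∈ T, c i • M i) = ∑ i ∈ T, c i • partialTranspose S (M i) := by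
  ext i j
  simp [partialTranspose, Matrix.sum_apply]

theorem conjOn_pow_four {S : Finset (Fin 3)} {k : Fin 3} {x : ℂ} (hx : x ^ 4 = -1) :
    conjOn S k x ^ 4 = -1 := by
  unfold conjOn
  split_ifs
  exacts [by rw [← star_pow, hx, star_neg, star_one], hx]

theorem conjOn_signedTriple (S : Finset (Fin 3)) (a : Fin 3 → ℂ) (j : Fin 8) :
    (fun k => conjOn S k (signedTriple a j k)) = signedTriple (fun k => conjOn S k (a k)) j := by
  funext k
  induction j using Fin.addCases (m := 4) (n := 4) with
  | left j =>
    simp only [signedTriple, Fin.append_left, conjOn]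
    split_ifs
    exacts [star_smul _ _, rfl]
  | right j =>
    simp only [signedTriple, Fin.append_right, conjOn]
    split_ifs
    exacts [star_smul _ _, rfl]

theorem conjOn_weight_mul_phase (S : Finset (Fin 3)) (k : Fin 3) (s : ℝ) (α : ℂ) :
    conjOn S k (![(s : ℂ), 1] * ![1, α]) = ![(s : ℂ), 1] * ![1, conjOn S k α] := by
  unfold conjOn
  split_ifs
  · funext i
    fin_cases i <;> simp
  · rfl

theorem partialTranspose_vecMulVec_weightVec_mul_phaseVec (S : Finset (Fin 3)) (p q r : ℝ)
    (a : Fin 3 → ℂ) :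
    partialTranspose S (Matrix.vecMulVec (weightVec p q r * phaseVec a)
        (star (weightVec p q r * phaseVec a))) =
      Matrix.vecMulVec (weightVec p q r * phaseVec fun k => conjOn S k (a k))
        (star (weightVec p q r * phaseVec fun k => conjOn S k (a k))) := by
  simp only [weightVec, phaseVec, ← prodVec_mul, partialTranspose_vecMulVec,
    conjOn_weight_mul_phase]

theorem posDef_partialTranspose_sum_phase (hp : 0 < p) (hq : 0 < q) (hr : 0 < r)
    (S : Finset (Fin 3)) {c : Fin 8 → ℝ} (hc : ∀ j, 0 < c j) :
    (∑ j, c j • partialTranspose S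
      (pureState (weightVec p q r * phaseVec (phase j)))).PosDef := by
  have hlin := linearIndependent_weightVec_mul_phaseVec hp hq hr
    (a := fun k => conjOn S k ((![ω ^ 3, ω, ω ^ 7] : Fin 3 → ℂ) k))
    fun k => conjOn_pow_four (base_phase_pow_four k)
  choose t ht hpure using fun j => exists_pos_pureState_eq_smul
    (weightVec_mul_ne_zero hp hq hr (ζ := phaseVec (phase j)) fun h => by
      simpa [h] using norm_phaseVec_phase j (0, 0, 0))
  have hterm (j : Fin 8) := partialTranspose_vecMulVec_weightVec_mul_phaseVec S p q r (phase j)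
  simp only [phase_eq_signedTriple, conjOn_signedTriple] at hterm hpure ⊢
  have hsmul (j : Fin 8) (s : ℝ) (M : Mat) :
      c j • partialTranspose S (s • M) = (c j * s) • partialTranspose S M :=
    (mul_smul (c j) s (partialTranspose S M)).symm
  simp only [hpure, hsmul, hterm]
  exact posDef_sum_smul_vecMulVec (hlin.span_eq_top_of_card_eq_finrank' (by simp))
    fun j => mul_pos (hc j) (ht j)

theorem rank_partialTranspose_sum_vertex (hp : 0 < p) (hq : 0 < q) (hr : 0 < r) (b : Idx)
    (S : Finset (Fin 3)) {c : Fin 10 → ℝ} (hc : ∀ i, 0 < c i) :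
    (partialTranspose S (∑ i, c i • vertex p q r b i)).rank = 8 := by
  have hsingle : (∑ j : Fin 2, c (Fin.castAdd 8 j) •
      partialTranspose S (vertex p q r b (Fin.castAdd 8 j))).PosSemidef :=
    Matrix.posSemidef_sum _ fun j _ => (posSemidef_partialTranspose S
      (vertex_mem_pureProductStates hp hq hr b _)).smul (hc _).le
  have hphase : (∑ j : Fin 8, c (Fin.natAdd 2 j) •
      partialTranspose S (vertex p q r b (Fin.natAdd 2 j))).PosDef := by
    simp only [vertex_natAdd]
    exact posDef_partialTranspose_sum_phase hp hq hr S fun j => hc _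
  have hpos := hphase.posSemidef_add hsingle
  rw [← Fin.sum_univ_add (a := 2) (b := 8)
    fun i => c i • partialTranspose S (vertex p q r b i)] at hpos
  rw [partialTranspose_sum_smul]
  exact Matrix.rank_of_isUnit _ hpos.isUnit

end FullRank

section Face

variable {p q r : ℝ} {b : Idx} {ρ : Mat}

theorem witnessForm_single_sub_single (b : Idx) :
    witnessForm b (Pi.single b 1 - Pi.single (opp b) (antiSign b : ℂ)) = -6 := by
  set ζ : Idx → ℂ := Pi.single b 1 - Pi.single (opp b) (antiSign b : ℂ)
  have hb : ζ b = 1 := by simp [ζ, (opp_ne b).symm]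
  have hopp : ζ (opp b) = -antiSign b := by simp [ζ, opp_ne b]
  have hzero (i : Idx) (hi : i ≠ b) (hi' : i ≠ opp b) : ζ i = 0 := by simp [ζ, hi, hi']
  have hsq : antiSign b * antiSign b = 1 := by
    unfold antiSign
    split_ifs <;> norm_num
  have hdiag : ∑ i ∈ {b, opp b}ᶜ, ‖ζ i‖ ^ 2 = 0 := Finset.sum_eq_zero fun i hi => by
    simp only [Finset.mem_compl, Finset.mem_insert, Finset.mem_singleton, not_or] at hi
    rw [hzero i hi.1 hi.2, norm_zero, zero_pow two_ne_zero]
  have hanti : ∑ i, antiSign i * (ζ i * star (ζ (opp i))).re = -2 := by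
    rw [Finset.sum_eq_add_of_mem b (opp b) (Finset.mem_univ _) (Finset.mem_univ _) (opp_ne b).symm
      fun i _ hi => by rw [hzero i hi.1 hi.2, zero_mul, Complex.zero_re, mul_zero],
      opp_involutive b, hb, hopp, antiSign_opp]
    simp only [star_neg, Complex.star_def, Complex.conj_ofReal, one_mul, map_one, mul_one,
      Complex.neg_re, Complex.ofReal_re]
    linarith
  rw [witnessForm, hdiag, hanti]
  norm_num

theorem isEntanglementWitness_xWitness (hp : 0 < p) (hq : 0 < q) (hr : 0 < r) (b : Idx) :
    IsEntanglementWitness (xWitness p q r b) := by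
  refine ⟨isHermitian_xWitness p q r b, fun ρ hρ => ?_, ?_⟩
  · exact convexHull_min (pairingRe_xWitness_nonneg hp hq hr b)
      (convex_halfSpace_ge (pairingRe (xWitness p q r b)).isLinear 0) hρ
  · have hform := witnessForm_single_sub_single b
    have hne : (Pi.single b 1 - Pi.single (opp b) (antiSign b : ℂ) : Idx → ℂ) ≠ 0 := fun h => by
      rw [h] at hform
      simp [witnessForm] at hform
    obtain ⟨t, ht, hpair⟩ := exists_pos_pairingRe_pureState_eq_mul hp hq hr b hne
    refine ⟨_, pureState_mem_states (weightVec_mul_ne_zero hp hq hr hne), hpair.trans_lt ?_⟩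
    rw [hform]
    linarith

theorem pairingRe_xWitness_single_pos (hp : 0 < p) (hq : 0 < q) (hr : 0 < r) {k : Idx}
    (hk : k ≠ b) (hk' : k ≠ opp b) :
    0 < pairingRe (xWitness p q r b) (pureState (Pi.single k 1)) := by
  obtain ⟨t, ht, hpair⟩ := exists_pos_pairingRe_pureState_eq_mul hp hq hr b
    (Pi.single_ne_zero_iff.2 one_ne_zero : (Pi.single k 1 : Idx → ℂ) ≠ 0)
  rw [← pureState_weightVec_mul_single hp hq hr, hpair, witnessForm_single, if_neg (by tauto)]
  positivity

theorem mem_intrinsicFrontier_separableStates (hp : 0 < p) (hq : 0 < q) (hr : 0 < r)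
    (hρ : ρ ∈ dualFace (xWitness p q r b)) : ρ ∈ intrinsicFrontier ℝ separableStates := by
  have hclosure : ρ ∈ intrinsicClosure ℝ separableStates := subset_intrinsicClosure hρ.1
  rw [← intrinsicInterior_union_intrinsicFrontier] at hclosure
  refine hclosure.resolve_left fun hint => ?_
  obtain ⟨k, hk, hk'⟩ := exists_ne_and_ne_opp b
  have hmem : pureState (Pi.single k 1) ∈ pureProductStates := by
    rw [← prodVec_single]
    exact pureState_prodVec_mem (prodVec_single k ▸ Pi.single_ne_zero_iff.2 one_ne_zero)
  have hpos := pos_of_mem_intrinsicInterior (f := pairingRe (xWitness p q r b))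
    (isEntanglementWitness_xWitness hp hq hr b).2.1 (subset_convexHull ℝ _ hmem)
    (pairingRe_xWitness_single_pos hp hq hr hk hk') hint
  exact hpos.ne' (congrArg Complex.re hρ.2)

theorem existsUnique_isDecomposition (hp : 0 < p) (hq : 0 < q) (hr : 0 < r)
    (hρ : ρ ∈ dualFace (xWitness p q r b)) : ∃! w, IsDecomposition ρ w := by
  obtain ⟨w, hw⟩ := exists_isDecomposition hρ.1
  exact ⟨w, hw, fun w' hw' => hw'.eq_of_linearIndependent (pairingRe_xWitness_nonneg hp hq hr b)
    (linearIndependent_vertex hp hq hr b) (sep_pairingRe_xWitness_eq_zero hp hq hr b)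
    (congrArg Complex.re hρ.2) hw⟩

theorem isBoundarySeparableFullRanks_and_sepLength (hp : 0 < p) (hq : 0 < q) (hr : 0 < r)
    (hρ : ρ ∈ intrinsicInterior ℝ (dualFace (xWitness p q r b))) :
    IsBoundarySeparableFullRanks ρ ∧ sepLength ρ = 10 := by
  have hmem := intrinsicInterior_subset hρ
  have hv := linearIndependent_vertex hp hq hr b
  rw [dualFace_xWitness hp hq hr] at hρ
  obtain ⟨c, hc0, hc1, rfl⟩ := exists_pos_of_mem_intrinsicInterior_convexHull hv hρ
  exact ⟨⟨hmem.1, mem_intrinsicFrontier_separableStates hp hq hr hmem,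
      fun S => rank_partialTranspose_sum_vertex hp hq hr b S hc0⟩,
    sepLength_eq_card_of_pos (pairingRe_xWitness_nonneg hp hq hr b) hv
      (sep_pairingRe_xWitness_eq_zero hp hq hr b) hc0 hc1 rfl⟩

theorem eq_xWitness_of_mem {u : ℝ} (hu : 0 < u) {V : Mat} {b₁ b₂ : Idx}
    (hV : (V, b₁, b₂, p, q, r) ∈
      ({(W u + WA u + WB u, (0, 1, 0), (1, 0, 1), 1, 1, u⁻¹),
        (W u + WB u + WC u, (0, 0, 0), (1, 1, 1), u, 1, 1),
        (W u + WC u + WA u, (0, 0, 1), (1, 1, 0), 1, u⁻¹, 1),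
        (WA u + WB u + WC u, (0, 1, 1), (1, 0, 0), u, u⁻¹, u⁻¹)} :
        Set (Mat × Idx × Idx × ℝ × ℝ × ℝ))) :
    0 < p ∧ 0 < q ∧ 0 < r ∧ opp b₁ = b₂ ∧ xWitness p q r b₁ = V := by
  have hu' : 0 < u⁻¹ := inv_pos.2 hu
  simp only [Set.mem_insert_iff, Set.mem_singleton_iff, Prod.mk.injEq] at hV
  rcases hV with ⟨rfl, rfl, rfl, rfl, rfl, rfl⟩ | ⟨rfl, rfl, rfl, rfl, rfl, rfl⟩ |
    ⟨rfl, rfl, rfl, rfl, rfl, rfl⟩ | ⟨rfl, rfl, rfl, rfl, rfl, rfl⟩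
  · exact ⟨one_pos, one_pos, hu', rfl, W_add_WA_add_WB.symm⟩
  · exact ⟨hu, one_pos, one_pos, rfl, W_add_WB_add_WC.symm⟩
  · exact ⟨one_pos, hu', one_pos, rfl, W_add_WC_add_WA.symm⟩
  · exact ⟨hu, hu', hu', rfl, (WA_add_WB_add_WC hu.ne').symm⟩

end Face

end ThreeQubit

theorem theorem3p1_general {p q r : ℝ} (hp : 0 < p) (hq : 0 < q) (hr : 0 < r) (b : Idx) :
    IsEntanglementWitness (xWitness p q r b) ∧
    (AffinelyIsomorphic (stdSimplex ℝ (Fin 10)) (dualFace (xWitness p q r b)) ∧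
      (dualFace (xWitness p q r b)).extremePoints ℝ =
        {pureState (Pi.single b 1), pureState (Pi.single (opp b) 1)} ∪
          Set.range (fun j : Fin 8 => pureState (eta p q r j)) ∧
      ((dualFace (xWitness p q r b)).extremePoints ℝ).ncard = 10) ∧
    (∀ ρ ∈ dualFace (xWitness p q r b),
      ρ ∈ separableStates ∧ ∃! w : Mat →₀ ℝ, IsDecomposition ρ w) ∧
    (∀ ρ ∈ intrinsicInterior ℝ (dualFace (xWitness p q r b)),
      IsBoundarySeparableFullRanks ρ ∧ sepLength ρ = 10) := by
  have hv := linearIndependent_vertex hp hq hr b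
  have hface := dualFace_xWitness hp hq hr b
  have hext : (dualFace (xWitness p q r b)).extremePoints ℝ = Set.range (vertex p q r b) := by
    rw [hface, extremePoints_convexHull_range hv]
  refine ⟨isEntanglementWitness_xWitness hp hq hr b, ⟨?_, ?_, ?_⟩, ?_, ?_⟩
  · exact hface ▸ affinelyIsomorphic_convexHull_range hv
  · rw [hext, range_vertex hp hq hr]
  · rw [hext, Set.ncard_range_of_injective hv.injective, Nat.card_fin]
  · exact fun ρ hρ => ⟨hρ.1, existsUnique_isDecomposition hp hq hr hρ⟩
  · exact fun ρ hρ => isBoundarySeparableFullRanks_and_sepLength hp hq hr hρ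

theorem theorem3p1 (u : ℝ) (hu : 0 < u) (V : Mat) (b₁ b₂ : Idx) (p q r : ℝ)
    (hV : (V, b₁, b₂, p, q, r) ∈
      ({(W u + WA u + WB u, (0, 1, 0), (1, 0, 1), 1, 1, u⁻¹),
        (W u + WB u + WC u, (0, 0, 0), (1, 1, 1), u, 1, 1),
        (W u + WC u + WA u, (0, 0, 1), (1, 1, 0), 1, u⁻¹, 1),
        (WA u + WB u + WC u, (0, 1, 1), (1, 0, 0), u, u⁻¹, u⁻¹)} :
        Set (Mat × Idx × Idx × ℝ × ℝ × ℝ))) :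
    IsEntanglementWitness V ∧
    -- (i)
    (AffinelyIsomorphic (stdSimplex ℝ (Fin 10)) (dualFace V) ∧
      (dualFace V).extremePoints ℝ =
        {pureState (Pi.single b₁ 1), pureState (Pi.single b₂ 1)} ∪
          Set.range (fun j : Fin 8 => pureState (eta p q r j)) ∧
      ((dualFace V).extremePoints ℝ).ncard = 10) ∧
    -- (ii)
    (∀ ρ ∈ dualFace V, ρ ∈ separableStates ∧ ∃! w : Mat →₀ ℝ, IsDecomposition ρ w) ∧
    -- (iii)
    (∀ ρ ∈ intrinsicInterior ℝ (dualFace V),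
      IsBoundarySeparableFullRanks ρ ∧ sepLength ρ = 10) := by
  obtain ⟨hp, hq, hr, rfl, rfl⟩ := eq_xWitness_of_mem hu hV
  exact theorem3p1_general hp hq hr b₁
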